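/- Let $G=\mathrm{Sp}(1)^3$ act on $S^3\times\mathbb H$ ($S^3=\mathrm{Sp}(1)\subset\mathbb H$ the unit quaternions) by $(q_1,q_2,q_3)\cdot(x,y)=(q_1x\bar q_3,\,q_2y\bar q_3)$; this is the bundle $G\times_{K^+}\mathbb H$ with $K^+=\{(q,q',q)\}$ acting on $\mathbb H$ by $y\mapsto q'y\bar q$. For $T\in(0,\infty]$ let $M=\{(x,y):|y|<T\}$, let $M_o=\{(x,y)\in M: y\ne 0\}$ be its regular part, and let $\gamma(t)=(1,t)$. For $X\in\mathfrak g=\mathfrak{sp}(1)^3$ let $\hat X$ be the vector field $\hat X_p=\frac{d}{ds}\big|_{s=0}\exp(sX)\cdot p$. Put $j_+(X)=(X,-2X,X)$, $j_-(X)=(-2X,X,X)$ for $X\in\mathfrak{sp}(1)=\mathrm{Im}\,\mathbb H$, and let $e_1=\gamma'(t)$, let $e_2,e_3,e_4$ be the values at $\gamma(t)$ of the vector fields induced by $j_+(i),j_+(j),j_+(k)$, and $e_5,e_6,e_7$ those induced by $j_-(i),j_-(j),j_-(k)$; let $e^1,\dots,e^7$ be the dual coframe along $\gamma$ ($0<t<T$).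 A nearly parallel $\mathrm G_2$-structure (NP-structure) on a $7$-manifold is a smooth $3$-form $\varphi$ which at each point lies in the $\mathrm{GL}(7,\mathbb R)$-orbit of the standard form $e^{123}+e^{145}+e^{167}+e^{246}-e^{257}-e^{347}-e^{356}$ and satisfies $d\varphi=\lambda *_\varphi\varphi$ for some constant $\lambda\neq0$. Here $*_\varphi$ is the Hodge star of the metric $g_\varphi$ and the orientation induced by $\varphi$, which are determined by $\frac16\,\iota_v\varphi\wedge\iota_w\varphi\wedge\varphi=g_\varphi(v,w)\,\mathrm{vol}_\varphi$. Let $\varphi$ be a $G$-invariant $3$-form on $M_o$ which defines an NP-structure on $M_o$, and write, for $0<t<T$, $$\varphi|_{\gamma(t)}=f_0(e^{125}+e^{136}+e^{147})+f_1e^{234}+f_2e^{567}+f_3(e^{237}-e^{246}+e^{345})+f_4(e^{267}-e^{357}+e^{456}),\qquad f_i=f_i(t).$$ Then $\varphi$ extends smoothly to a $G$-invariant $3$-form on $M$ defining an NP-structure on $M$ if and only if the functions $f_i$ extend to smooth functions on some interval $(-\varepsilon,\varepsilon)$, $0<\varepsilon\le T$, which satisfy all of the following conditions: (1) $f_0$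 is odd and $f_1,f_2,f_3,f_4$ are even; (2) $f_1(0)=f_3(0)=f_4(0)=0$; (3) $f_1''(0)=0$ and $6f_0'(0)=f_3''(0)$; (4) $f_2(0)\neq0$ and $f_0'(0)\neq0$. -/

import Mathlib

open scoped Manifold ContDiff Quaternion

noncomputable section

namespace NPExtension

/-! ### Linear algebra of `G₂`-forms on a `7`-dimensional vector space -/

section LinearAlgebra

/-- The value of `e^i ∧ e^j ∧ e^k` on three vectors of `ℝ⁷` (indices `0, …, 6` stand for
`e¹, …, e⁷`). -/
def wedge3 (i j k : Fin 7) (c : Fin 3 → Fin 7 → ℝ) : ℝ :=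
  Matrix.det (Matrix.of fun a b : Fin 3 => c a (![i, j, k] b))

/-- The standard `3`-form on `ℝ⁷` with stabilizer `G₂`:
`e¹²³ + e¹⁴⁵ + e¹⁶⁷ + e²⁴⁶ - e²⁵⁷ - e³⁴⁷ - e³⁵⁶`. -/
def phiStd (c : Fin 3 → Fin 7 → ℝ) : ℝ :=
  wedge3 0 1 2 c + wedge3 0 3 4 c + wedge3 0 5 6 c + wedge3 1 3 5 c
    - wedge3 1 4 6 c - wedge3 2 3 6 c - wedge3 2 4 5 c

/-- The `3`-form
`f₀(e¹²⁵+e¹³⁶+e¹⁴⁷) + f₁ e²³⁴ + f₂ e⁵⁶⁷ + f₃(e²³⁷-e²⁴⁶+e³⁴⁵) + f₄(e²⁶⁷-e³⁵⁷+e⁴⁵⁶)` on `ℝ⁷`. -/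
def phiInv (f : Fin 5 → ℝ) (c : Fin 3 → Fin 7 → ℝ) : ℝ :=
  f 0 * (wedge3 0 1 4 c + wedge3 0 2 5 c + wedge3 0 3 6 c)
    + f 1 * wedge3 1 2 3 c + f 2 * wedge3 4 5 6 c
    + f 3 * (wedge3 1 2 6 c - wedge3 1 3 5 c + wedge3 2 3 4 c)
    + f 4 * (wedge3 1 5 6 c - wedge3 2 4 6 c + wedge3 3 4 5 c)

variable {V : Type*} [AddCommGroup V] [Module ℝ V] [TopologicalSpace V]

/-- A `3`-form is positive if it is the standard form `phiStd` in some basis, i.e. if it lies in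
the `GL(7, ℝ)`-orbit of the standard form. -/
def IsPositive (φ : V [⋀^Fin 3]→L[ℝ] ℝ) : Prop :=
  ∃ u : Module.Basis (Fin 7) ℝ V,
    ∀ w : Fin 3 → V, φ w = phiStd fun a i => u.repr (w a) i

/-- `β_φ(x, y)`: the value on the basis `v` of the `7`-form `(1/6) ι_x φ ∧ ι_y φ ∧ φ`. The wedge
product of forms of degrees `2, 2, 3` is the sum over permutations divided by `2! 2! 3!`. -/
def beta (v : Module.Basis (Fin 7) ℝ V) (φ : V [⋀^Fin 3]→L[ℝ] ℝ) (x y : V) : ℝ :=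
  (1 / 6) * ((1 / (2 * 2 * 6)) * ∑ σ : Equiv.Perm (Fin 7), ((Equiv.Perm.sign σ : ℤ) : ℝ) *
    (φ ![x, v (σ 0), v (σ 1)] * φ ![y, v (σ 2), v (σ 3)] * φ ![v (σ 4), v (σ 5), v (σ 6)]))

/-- The matrix `B_φ = (β_φ(v_i, v_j))`. -/
def betaMatrix (v : Module.Basis (Fin 7) ℝ V) (φ : V [⋀^Fin 3]→L[ℝ] ℝ) :
    Matrix (Fin 7) (Fin 7) ℝ :=
  Matrix.of fun i j => beta v φ (v i) (v j)

/-- The real ninth root (an odd function). -/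
def ninthRoot (x : ℝ) : ℝ := Real.sign x * |x| ^ (1 / 9 : ℝ)

/-- The Gram matrix `g_φ(v_i, v_j) = det(B_φ)^{-1/9} β_φ(v_i, v_j)` of the metric of `φ`. -/
def gMatrix (v : Module.Basis (Fin 7) ℝ V) (φ : V [⋀^Fin 3]→L[ℝ] ℝ) :
    Matrix (Fin 7) (Fin 7) ℝ :=
  (ninthRoot (betaMatrix v φ).det)⁻¹ • betaMatrix v φ

/-- The volume form `det(B_φ)^{1/9} v¹ ∧ … ∧ v⁷` of `φ`. For positive `φ` this is the Riemannian
volume form of `g_φ` for the orientation induced by `φ`, the one with `b_φ = g_φ ⊗ vol_φ`: indeed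
`det g_φ = det(B_φ)^{2/9}`. -/
def volForm (v : Module.Basis (Fin 7) ℝ V) (φ : V [⋀^Fin 3]→L[ℝ] ℝ) (w : Fin 7 → V) : ℝ :=
  ninthRoot (betaMatrix v φ).det * v.det w

/-- The Hodge dual `*_φ φ` with respect to `g_φ` and `vol_φ`, computed in the basis `v`:
`(*φ)(w₁,…,w₄) = (1/3!) ∑ g^{i₁j₁} g^{i₂j₂} g^{i₃j₃} φ(v_{i₁},v_{i₂},v_{i₃})
vol(v_{j₁},v_{j₂},v_{j₃},w₁,…,w₄)`. -/
def hodgeDual (v : Module.Basis (Fin 7) ℝ V) (φ : V [⋀^Fin 3]→L[ℝ] ℝ) (w : Fin 4 → V) : ℝ :=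
  (1 / 6) * ∑ i : Fin 3 → Fin 7, ∑ j : Fin 3 → Fin 7,
    (∏ a, (gMatrix v φ)⁻¹ (i a) (j a)) * φ (fun a => v (i a)) *
      volForm v φ (Fin.append (fun a => v (j a)) w)

end LinearAlgebra

/-! ### The manifold, the group and the action -/

/-- `Sp(1)`, the group of unit quaternions; also the sphere `S³` as a manifold. -/
abbrev Sp1 : Type := Metric.sphere (0 : ℍ[ℝ]) 1

instance finrank_quaternion_fact : Fact (Module.finrank ℝ ℍ[ℝ] = 3 + 1) :=
  ⟨Quaternion.finrank_eq_four⟩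

/-- `G = Sp(1)³`. -/
abbrev G : Type := Sp1 × Sp1 × Sp1

/-- The manifold `S³ × ℍ`; it is `G ×_{K⁺} ℍ`, see `ofBundle_surjective`, `ofBundle_eq_iff`. -/
abbrev M : Type := Sp1 × ℍ[ℝ]

/-- The model vector space of `M`. -/
abbrev E : Type := EuclideanSpace ℝ (Fin 3) × ℍ[ℝ]

/-- The model with corners of `M` (without boundary). -/
abbrev IM : ModelWithCorners ℝ E (ModelProd (EuclideanSpace ℝ (Fin 3)) ℍ[ℝ]) :=
  (𝓡 3).prod 𝓘(ℝ, ℍ[ℝ])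

/-- The action `(q₁, q₂, q₃) · (x, y) = (q₁ x q₃⁻¹, q₂ y q₃⁻¹)`, i.e. the restriction of the
action of `Sp(2) × Sp(1)` on `ℍ²`. -/
def act (g : G) (p : M) : M :=
  (g.1 * p.1 * g.2.2⁻¹, (g.2.1 : ℍ[ℝ]) * p.2 * ((g.2.2⁻¹ : Sp1) : ℍ[ℝ]))

/-- The map `G × ℍ → M`, `(g, y) ↦ g · (1, y)`. It identifies `M` with the associated bundle
`G ×_{K⁺} ℍ`, where `K⁺ = {(q, q', q)}` acts on `ℍ` by `y ↦ q' y q⁻¹`. -/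
def ofBundle (a : G × ℍ[ℝ]) : M := act a.1 (1, a.2)

theorem ofBundle_surjective : Function.Surjective ofBundle := by
  rintro ⟨x, y⟩
  refine ⟨((x, 1, 1), y), ?_⟩
  simp [ofBundle, act]

theorem ofBundle_eq_iff (g g' : G) (y y' : ℍ[ℝ]) :
    ofBundle (g, y) = ofBundle (g', y') ↔
      ∃ q q' : Sp1, g' = g * (q, q', q) ∧
        y = (q' : ℍ[ℝ]) * y' * ((q⁻¹ : Sp1) : ℍ[ℝ]) := by
  obtain ⟨a, b, c⟩ := g
  obtain ⟨a', b', c'⟩ := g'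
  have inv_l : ∀ q : Sp1, ((q⁻¹ : Sp1) : ℍ[ℝ]) * (q : ℍ[ℝ]) = 1 := fun q =>
    congrArg Subtype.val (inv_mul_cancel q)
  have inv_r : ∀ q : Sp1, (q : ℍ[ℝ]) * ((q⁻¹ : Sp1) : ℍ[ℝ]) = 1 := fun q =>
    congrArg Subtype.val (mul_inv_cancel q)
  constructor
  · intro h
    have h1 : a * c⁻¹ = a' * c'⁻¹ := by simpa [ofBundle, act] using congrArg Prod.fst h
    have h2 : (b : ℍ[ℝ]) * y * ((c⁻¹ : Sp1) : ℍ[ℝ]) = b' * y' * ((c'⁻¹ : Sp1) : ℍ[ℝ]) :=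
      congrArg Prod.snd h
    have h3 : a' = a * (c⁻¹ * c') := by rw [← mul_assoc, h1]; group
    refine ⟨c⁻¹ * c', b⁻¹ * b', ?_, ?_⟩
    · simp [h3]
    · have e1 : ((b⁻¹ * b' : Sp1) : ℍ[ℝ]) = ((b⁻¹ : Sp1) : ℍ[ℝ]) * b' := rfl
      have e2 : (((c⁻¹ * c')⁻¹ : Sp1) : ℍ[ℝ]) = ((c'⁻¹ : Sp1) : ℍ[ℝ]) * c := by
        rw [mul_inv_rev, inv_inv]; rfl
      calc y = (((b⁻¹ : Sp1) : ℍ[ℝ]) * b) * y * (((c⁻¹ : Sp1) : ℍ[ℝ]) * c) := by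
            rw [inv_l, inv_l]; simp
        _ = ((b⁻¹ : Sp1) : ℍ[ℝ]) * ((b : ℍ[ℝ]) * y * ((c⁻¹ : Sp1) : ℍ[ℝ])) * c := by
            simp only [mul_assoc]
        _ = _ := by rw [h2, e1, e2]; simp only [mul_assoc]
  · rintro ⟨q, q', h, rfl⟩
    simp only [Prod.mk_mul_mk, Prod.mk.injEq] at h
    obtain ⟨rfl, rfl, rfl⟩ := h
    refine Prod.ext ?_ ?_
    · change a * 1 * c⁻¹ = a * q * 1 * (c * q)⁻¹
      group
    · change (b : ℍ[ℝ]) * ((q' : ℍ[ℝ]) * y' * ((q⁻¹ : Sp1) : ℍ[ℝ])) * ((c⁻¹ : Sp1) : ℍ[ℝ])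
        = ((b * q' : Sp1) : ℍ[ℝ]) * y' * (((c * q)⁻¹ : Sp1) : ℍ[ℝ])
      have e1 : ((b * q' : Sp1) : ℍ[ℝ]) = (b : ℍ[ℝ]) * q' := rfl
      have e2 : (((c * q)⁻¹ : Sp1) : ℍ[ℝ]) = ((q⁻¹ : Sp1) : ℍ[ℝ]) * ((c⁻¹ : Sp1) : ℍ[ℝ]) := by
        rw [mul_inv_rev]; rfl
      rw [e1, e2]
      simp only [mul_assoc]

/-- The tube of radius `T ∈ (0, ∞]` around the singular orbit `{y = 0}`. -/
def tube (T : EReal) : Set M := {p | ((‖p.2‖ : ℝ) : EReal) < T}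

/-- The regular part of the tube: the complement of the singular orbit. -/
def regularTube (T : EReal) : Set M := {p | p ∈ tube T ∧ p.2 ≠ 0}

/-- The curve `γ(t) = (1, t)`. -/
def gamma (t : ℝ) : M := (1, (t : ℍ[ℝ]))

/-- The exponential map `sp(1) → Sp(1)`, where `sp(1)` is the space of imaginary quaternions. -/
def expSp (X : ℍ[ℝ]) : Sp1 :=
  ⟨NormedSpace.exp X.im, by simp [Quaternion.norm_exp]⟩

/-- The vector field on `M` induced by `X = (X₁, X₂, X₃) ∈ sp(1)³`, i.e. the velocity at `s = 0`
of `s ↦ exp(sX) · p`. -/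
def killing (X : ℍ[ℝ] × ℍ[ℝ] × ℍ[ℝ]) (p : M) : TangentSpace IM p :=
  (mfderiv 𝓘(ℝ, ℝ) IM
    (fun s : ℝ => act (expSp (s • X.1), expSp (s • X.2.1), expSp (s • X.2.2)) p) 0 (1 : ℝ) : E)

/-- The basis `h, e, v` of `sp(1)`: the quaternions `i, j, k`; so `[h,e] = 2v`, `[h,v] = -2e`,
`[e,v] = 2h`. -/
def sp1Basis : Fin 3 → ℍ[ℝ] := ![⟨0, 1, 0, 0⟩, ⟨0, 0, 1, 0⟩, ⟨0, 0, 0, 1⟩]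

/-- `j₊(X) = (X, -2X, X)`. -/
def jPlus (X : ℍ[ℝ]) : ℍ[ℝ] × ℍ[ℝ] × ℍ[ℝ] := (X, (-2 : ℝ) • X, X)

/-- `j₋(X) = (-2X, X, X)`. -/
def jMinus (X : ℍ[ℝ]) : ℍ[ℝ] × ℍ[ℝ] × ℍ[ℝ] := ((-2 : ℝ) • X, X, X)

/-- The frame `e₁ = γ'(t)`, `e₂, e₃, e₄` (induced by `j₊` of `h, e, v`) and `e₅, e₆, e₇`
(induced by `j₋` of `h, e, v`) along `γ`. -/
def frame (t : ℝ) : Fin 7 → TangentSpace IM (gamma t) :=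
  ![(mfderiv 𝓘(ℝ, ℝ) IM gamma t (1 : ℝ) : E),
    killing (jPlus (sp1Basis 0)) (gamma t),
    killing (jPlus (sp1Basis 1)) (gamma t),
    killing (jPlus (sp1Basis 2)) (gamma t),
    killing (jMinus (sp1Basis 0)) (gamma t),
    killing (jMinus (sp1Basis 1)) (gamma t),
    killing (jMinus (sp1Basis 2)) (gamma t)]

/-! ### Differential forms on `M` -/

/-- A (not necessarily smooth) `3`-form on `M`. -/
abbrev ThreeForm : Type := (p : M) → TangentSpace IM p [⋀^Fin 3]→L[ℝ] ℝ

/-- The local expression of a `3`-form in the chart of `M` around `x`. -/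
def localForm (x : M) (φ : ThreeForm) (z : E) : E [⋀^Fin 3]→L[ℝ] ℝ :=
  (φ ((extChartAt IM x).symm z)).compContinuousLinearMap
    (mfderiv 𝓘(ℝ, E) IM (extChartAt IM x).symm z)

/-- The part of the chart of `M` around `x` that corresponds to points of `U`. -/
def chartSet (x : M) (U : Set M) : Set E :=
  (extChartAt IM x).target ∩ (extChartAt IM x).symm ⁻¹' U

/-- `φ` is smooth on the open set `U`. -/
def SmoothOn (U : Set M) (φ : ThreeForm) : Prop :=
  ∀ x : M, ContDiffOn ℝ ∞ (localForm x φ) (chartSet x U)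

/-- `φ` is `G`-invariant on the `G`-invariant set `U`. -/
def InvariantOn (U : Set M) (φ : ThreeForm) : Prop :=
  ∀ g : G, ∀ p ∈ U, (φ (act g p)).compContinuousLinearMap (mfderiv IM IM (act g) p) = φ p

/-- `φ` defines a nearly parallel `G₂`-structure on the open set `U`: it is a smooth positive
`3`-form with `dφ = λ *_φ φ` (in all charts) for some constant `λ ≠ 0`. -/
structure IsNearlyParallel (U : Set M) (φ : ThreeForm) : Prop where
  smooth : SmoothOn U φ
  positive : ∀ p ∈ U, IsPositive (φ p)
  equation : ∃ l : ℝ, l ≠ 0 ∧ ∀ x : M, ∀ z ∈ chartSet x U, ∀ v : Module.Basis (Fin 7) ℝ E,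
    ∀ w : Fin 4 → E, extDeriv (localForm x φ) z w = l * hodgeDual v (localForm x φ z) w

/-- The restriction of `φ` to `γ(t)`, `0 < t < T`, is
`f₀(e¹²⁵+e¹³⁶+e¹⁴⁷) + f₁ e²³⁴ + f₂ e⁵⁶⁷ + f₃(e²³⁷-e²⁴⁶+e³⁴⁵) + f₄(e²⁶⁷-e³⁵⁷+e⁴⁵⁶)`
in the coframe dual to `frame t`. -/
def HasComponents (T : EReal) (φ : ThreeForm) (f : Fin 5 → ℝ → ℝ) : Prop :=
  ∀ t : ℝ, 0 < t → (t : EReal) < T → ∀ c : Fin 3 → Fin 7 → ℝ,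
    φ (gamma t) (fun a => ∑ i, c a i • frame t i) = phiInv (fun k => f k t) c

/-- The functions `f₀, …, f₄` on `(0, T)` extend smoothly to a neighbourhood `(-ε, ε)` of `0`,
and the extensions satisfy the parity, vanishing and non-degeneracy conditions. -/
def ExtensionConditions (T : EReal) (f : Fin 5 → ℝ → ℝ) : Prop :=
  ∃ ε : ℝ, 0 < ε ∧ (ε : EReal) ≤ T ∧ ∃ F : Fin 5 → ℝ → ℝ,
    (∀ k, ContDiffOn ℝ ∞ (F k) (Set.Ioo (-ε) ε)) ∧
    (∀ k, ∀ t ∈ Set.Ioo 0 ε, F k t = f k t) ∧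
    (∀ t ∈ Set.Ioo (-ε) ε, F 0 (-t) = -F 0 t) ∧
    (∀ k, k ≠ 0 → ∀ t ∈ Set.Ioo (-ε) ε, F k (-t) = F k t) ∧
    F 1 0 = 0 ∧ F 3 0 = 0 ∧ F 4 0 = 0 ∧
    iteratedDeriv 2 (F 1) 0 = 0 ∧
    6 * deriv (F 0) 0 = iteratedDeriv 2 (F 3) 0 ∧
    F 2 0 ≠ 0 ∧ deriv (F 0) 0 ≠ 0

end NPExtension

end

open NPExtension

open scoped Manifold ContDiff Quaternion

namespace NPExtension

/-! ### Division of smooth functions of one variable -/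

section Hadamard

open MeasureTheory intervalIntegral

/-! Left translation in the `Sp(1)`-factor trivializes `M`, so an invariant form is the same as a
family `Ψ(y)` of 3-forms on the fixed space `E`, `y ∈ ℍ`, equivariant under `K⁺`; smoothness on `M`
is smoothness of `Ψ`. Away from `0`, the element `q' = ȳ/|y|` rotates `y` to `|y|` on `γ`, which
writes `Ψ(y)` as functions of `|y|` times forms whose coefficients are polynomial in `y`
(`HasComponents.fiberForm_eq_smoothFiberForm`).

The `f₁`-term is `f₁/t⁴` times a smooth form, the `f₄`-term `f₄/t²` times one. The `f₀`- and
`f₃`-terms combine to `(3a₀M - a₃R)/(27t²)` with `a₀ = f₀/t`, `a₃ = f₃/t²`. Since `M - R` is `|y|²`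
times a constant form, splitting into `M + R` and `M - R` leaves only `(3a₀ - a₃)/t²` to be smooth.
A smooth even function of `|y|` is smooth in `y` (`contDiff_comp_norm_of_even`), so conditions
(1)-(3) allow all these divisions. The value at `0` is `hyperkaehlerForm (-f₂(0)/27) (f₀'(0)/9)`,
which is positive as soon as `f₂(0) f₀'(0) < 0`. Condition (4) gives only that the product is
nonzero; its sign comes from positivity on the regular part, which forces `f₂ f₃ ≤ f₄²`
(`IsPositive.phiInv_le`). Finally `dφ = λ *φ` passes to the singular orbit by continuity, because
`*φ` is continuous in `φ` near positive forms (`IsPositive.det_betaMatrix_ne_zero`,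
`continuousAt_hodgeDual`).

Conversely, the vertical frame vectors are `-3t` times constant vectors, so the components of a
smooth extension are divisible by powers of `t`. The element acting as `-1` on `ℍ` gives the
parities, left multiplication by `i` at the origin gives `6f₀'(0) = f₃''(0)`, and nondegeneracy of a
positive form at the origin gives (4). -/

theorem hasDerivAt_integral_pow_mul_comp_mul {h : ℝ → ℝ} (hh : ContDiff ℝ ∞ h) (m : ℕ) (t : ℝ) :
    HasDerivAt (fun t => ∫ s in (0 : ℝ)..1, s ^ m * h (s * t))
      (∫ s in (0 : ℝ)..1, s ^ (m + 1) * deriv h (s * t)) t := by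
  have hd : Continuous (deriv h) := hh.continuous_deriv (by simp)
  have hc : Continuous h := hh.continuous
  have hdiff : Differentiable ℝ h := hh.differentiable (by simp)
  -- For `|x - t| < 1` and `0 ≤ s ≤ 1` the point `s x` stays in this interval, so one constant
  -- dominates the integrand.
  obtain ⟨C, hC⟩ := (isCompact_Icc (a := -(|t| + 1)) (b := |t| + 1)).exists_bound_of_continuousOn
    hd.continuousOn
  refine (intervalIntegral.hasDerivAt_integral_of_dominated_loc_of_deriv_le
    (F := fun t s => s ^ m * h (s * t)) (F' := fun t s => s ^ (m + 1) * deriv h (s * t))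
    (bound := fun _ => C) (Metric.ball_mem_nhds t one_pos) ?_ ?_ ?_ ?_ ?_ ?_).2
  · exact Filter.Eventually.of_forall fun x =>
      (Continuous.aestronglyMeasurable (by fun_prop))
  · exact Continuous.intervalIntegrable (by fun_prop) _ _
  · exact Continuous.aestronglyMeasurable (by fun_prop)
  · refine Filter.Eventually.of_forall fun s hs x hx => ?_
    rw [Set.uIoc_of_le zero_le_one] at hs
    have hs0 : 0 ≤ s := hs.1.le
    have hs1 : s ≤ 1 := hs.2
    have hx' : |x| ≤ |t| + 1 := by
      have h1 : |x - t| < 1 := by simpa [Real.dist_eq] using hx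
      have h2 := abs_sub_abs_le_abs_sub x t
      linarith
    have hsx : |s * x| ≤ |t| + 1 := by
      rw [abs_mul, abs_of_nonneg hs0]
      nlinarith [abs_nonneg x]
    have h1 := hC (s * x) (abs_le.mp hsx)
    rw [norm_mul, Real.norm_of_nonneg (pow_nonneg hs0 _)]
    have h2 : s ^ (m + 1) ≤ 1 := pow_le_one₀ hs0 hs1
    nlinarith [norm_nonneg (deriv h (s * x))]
  · exact intervalIntegrable_const
  · refine Filter.Eventually.of_forall fun s _ x _ => ?_
    have h1 : HasDerivAt (fun x => h (s * x)) (deriv h (s * x) * (s * 1)) x :=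
      (hdiff (s * x)).hasDerivAt.comp x ((hasDerivAt_id x).const_mul s)
    convert! h1.const_mul (s ^ m) using 1
    ring

/-- Differentiation replaces `(m, h)` by `(m + 1, h')`, so the family is closed under derivatives
and induction on the order works with `m` and `h` free. -/
theorem contDiff_integral_pow_mul_comp_mul {h : ℝ → ℝ} (hh : ContDiff ℝ ∞ h) (m : ℕ) :
    ContDiff ℝ ∞ (fun t => ∫ s in (0 : ℝ)..1, s ^ m * h (s * t)) := by
  rw [contDiff_infty]
  intro n
  induction n generalizing h m with
  | zero =>
    exact contDiff_zero.2 (continuous_iff_continuousAt.2 fun t =>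
      (hasDerivAt_integral_pow_mul_comp_mul hh m t).continuousAt)
  | succ n ih =>
    have hd : deriv (fun t => ∫ s in (0 : ℝ)..1, s ^ m * h (s * t)) =
        fun t => ∫ s in (0 : ℝ)..1, s ^ (m + 1) * deriv h (s * t) :=
      funext fun t => (hasDerivAt_integral_pow_mul_comp_mul hh m t).deriv
    push_cast
    rw [contDiff_succ_iff_deriv]
    refine ⟨fun t => (hasDerivAt_integral_pow_mul_comp_mul hh m t).differentiableAt, by simp, ?_⟩
    rw [hd]
    exact ih (contDiff_infty_iff_deriv.1 hh).2 (m + 1)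

/-- Hadamard's lemma in one variable. -/
theorem exists_contDiff_eq_mul {h : ℝ → ℝ} (hh : ContDiff ℝ ∞ h) (h0 : h 0 = 0) :
    ∃ k : ℝ → ℝ, ContDiff ℝ ∞ k ∧ ∀ t, h t = t * k t := by
  have hdiff : Differentiable ℝ h := hh.differentiable (by simp)
  have hd : Continuous (deriv h) := hh.continuous_deriv (by simp)
  -- The quotient is `∫₀¹ h'(st) ds`; the factor `s ^ 0` puts it in the family just shown to be
  -- smooth.
  refine ⟨fun t => ∫ s in (0 : ℝ)..1, s ^ 0 * deriv h (s * t),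
    contDiff_integral_pow_mul_comp_mul (contDiff_infty_iff_deriv.1 hh).2 0, fun t => ?_⟩
  have h1 : ∀ s ∈ Set.uIcc (0 : ℝ) 1, HasDerivAt (fun s => h (s * t)) (deriv h (s * t) * t) s :=
    fun s _ => by
      have := (hdiff (s * t)).hasDerivAt.comp s ((hasDerivAt_id s).mul_const t)
      simpa [Function.comp_def] using this
  have h2 := integral_eq_sub_of_hasDerivAt h1
    (Continuous.intervalIntegrable (by fun_prop) _ _)
  rw [intervalIntegral.integral_mul_const] at h2
  simp only [one_mul, zero_mul, h0, sub_zero] at h2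
  simp only [pow_zero, one_mul]
  rw [← h2, mul_comm]

/-- A smooth odd function is `t` times a smooth even function. -/
theorem exists_even_eq_mul_of_odd {h : ℝ → ℝ} (hh : ContDiff ℝ ∞ h) (ho : Function.Odd h) :
    ∃ k : ℝ → ℝ, ContDiff ℝ ∞ k ∧ Function.Even k ∧ ∀ t, h t = t * k t := by
  obtain ⟨k, hk, hkt⟩ := exists_contDiff_eq_mul hh ho.map_zero
  refine ⟨k, hk, fun t => ?_, hkt⟩
  by_cases ht : t = 0
  · simp [ht]
  · have h1 := ho t
    rw [hkt, hkt t] at h1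
    have : t * (k (-t) - k t) = 0 := by linarith
    rcases mul_eq_zero.1 this with h | h
    · exact absurd h ht
    · linarith

/-- A smooth even function vanishing at `0` is `t²` times a smooth even function. -/
theorem exists_even_eq_sq_mul {h : ℝ → ℝ} (hh : ContDiff ℝ ∞ h) (he : Function.Even h)
    (h0 : h 0 = 0) :
    ∃ k : ℝ → ℝ, ContDiff ℝ ∞ k ∧ Function.Even k ∧ ∀ t, h t = t ^ 2 * k t := by
  obtain ⟨u, hu, hut⟩ := exists_contDiff_eq_mul hh h0
  have huo : Function.Odd u := by
    have hne : ∀ t, t ≠ 0 → u (-t) = -u t := fun t ht => by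
      have h1 := he t
      rw [hut, hut t] at h1
      have : t * (u (-t) + u t) = 0 := by linarith
      rcases mul_eq_zero.1 this with h | h
      · exact absurd h ht
      · linarith
    -- Cancelling `t` proves oddness only for `t ≠ 0`; the value at `0` follows by density.
    have hcl : Set.EqOn (fun t => u (-t)) (fun t => -u t) (closure {0}ᶜ) :=
      Set.EqOn.closure (fun t ht => hne t ht) (hu.continuous.comp continuous_neg)
        hu.continuous.neg
    rw [closure_compl_singleton] at hcl
    exact fun t => hcl (Set.mem_univ t)
  obtain ⟨k, hk, hke, hkt⟩ := exists_even_eq_mul_of_odd hu huo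
  exact ⟨k, hk, hke, fun t => by rw [hut, hkt]; ring⟩

/-! ### Even functions of the norm -/

/-- The gradient of the norm is `y/|y|`, so that of `g(|y|)` is `(g'(|y|)/|y|) y = k(|y|) y`, with
no singularity left. At the origin `g'(0) = 0` makes the increment `o(|y|)`. -/
theorem hasFDerivAt_comp_norm_of_even {W : Type*} [NormedAddCommGroup W] [InnerProductSpace ℝ W]
    {g k : ℝ → ℝ} (hg : Differentiable ℝ g)
    (hgk : ∀ t, deriv g t = t * k t) (y : W) :
    HasFDerivAt (fun y : W => g ‖y‖) (k ‖y‖ • innerSL ℝ y) y := by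
  by_cases hy : y = 0
  · subst hy
    have h1 : HasDerivAt g 0 0 := by simpa [hgk] using (hg 0).hasDerivAt
    have h2 : HasFDerivAt (fun y : W => g ‖y‖) (0 : W →L[ℝ] ℝ) 0 := by
      rw [hasFDerivAt_iff_isLittleO_nhds_zero]
      rw [hasDerivAt_iff_isLittleO_nhds_zero] at h1
      have h3 : Filter.Tendsto (fun y : W => ‖y‖) (nhds 0) (nhds 0) := by
        simpa using (continuous_norm (E := W)).tendsto 0
      have h4 := h1.comp_tendsto h3
      simp only [Function.comp_def, zero_add, smul_zero, sub_zero] at h4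
      simpa using h4.trans_isBigO (Asymptotics.isBigO_refl _ _).norm_left
    simpa using h2
  · have hn : ‖y‖ ≠ 0 := norm_ne_zero_iff.2 hy
    have h1 : HasFDerivAt (fun y : W => ‖y‖) (‖y‖⁻¹ • innerSL ℝ y) y := by
      have h2 : HasFDerivAt (fun y : W => ‖y‖ ^ 2) (2 • innerSL ℝ y) y :=
        (hasStrictFDerivAt_norm_sq y).hasFDerivAt
      have h3 := h2.sqrt (by positivity)
      have h4 : (fun y : W => Real.sqrt (‖y‖ ^ 2)) = fun y : W => ‖y‖ :=
        funext fun y => Real.sqrt_sq (norm_nonneg y)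
      rw [h4, Real.sqrt_sq (norm_nonneg y)] at h3
      convert! h3 using 1
      ext w
      simp
      field_simp
    have h5 := (hg ‖y‖).hasDerivAt.comp_hasFDerivAt y h1
    convert! h5 using 1
    rw [hgk, smul_smul]
    congr 1
    field_simp

/-- A smooth even function of the norm is smooth. -/
theorem contDiff_comp_norm_of_even {W : Type*} [NormedAddCommGroup W] [InnerProductSpace ℝ W]
    {g : ℝ → ℝ} (hg : ContDiff ℝ ∞ g) (he : Function.Even g) :
    ContDiff ℝ ∞ (fun y : W => g ‖y‖) := by
  rw [contDiff_infty]
  intro n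
  induction n generalizing g with
  | zero => exact contDiff_zero.2 (hg.continuous.comp continuous_norm)
  | succ n ih =>
    have hdo : Function.Odd (deriv g) := fun t => by
      have h1 : (fun t => g (-t)) = g := funext he
      have h2 := deriv_comp_neg g t
      rw [h1] at h2
      linarith
    -- The quotient `k = g'(t)/t` is again smooth and even, so the induction hypothesis applies to
    -- the coefficient of the derivative.
    obtain ⟨k, hk, hke, hkt⟩ := exists_even_eq_mul_of_odd (contDiff_infty_iff_deriv.1 hg).2 hdo
    have hd := hasFDerivAt_comp_norm_of_even (W := W) (hg.differentiable (by simp))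
      hkt
    push_cast
    rw [contDiff_succ_iff_hasFDerivAt]
    exact ⟨_, (ih hk hke).smul (innerSL ℝ (E := W)).contDiff, hd⟩

theorem iteratedDeriv_two_sq_mul {k : ℝ → ℝ} (hk : ContDiff ℝ ∞ k) :
    iteratedDeriv 2 (fun t => t ^ 2 * k t) 0 = 2 * k 0 := by
  have hdiff : Differentiable ℝ k := hk.differentiable (by simp)
  have hdiff' : Differentiable ℝ (deriv k) :=
    (contDiff_infty_iff_deriv.1 hk).2.differentiable (by simp)
  have h1 : deriv (fun t => t ^ 2 * k t) = fun t => 2 * t * k t + t ^ 2 * deriv k t := by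
    funext t
    have := ((hasDerivAt_pow 2 t).mul (hdiff t).hasDerivAt).deriv
    simpa [Pi.mul_def] using this
  rw [iteratedDeriv_succ, iteratedDeriv_one, h1]
  have := ((((hasDerivAt_id (0 : ℝ)).const_mul 2).mul (hdiff 0).hasDerivAt).add
    ((hasDerivAt_pow 2 (0 : ℝ)).mul (hdiff' 0).hasDerivAt)).deriv
  simpa [Pi.mul_def, Pi.add_def] using this

end Hadamard

/-! ### Smooth families of alternating maps -/

section Alternating

variable {V : Type*} [NormedAddCommGroup V] [NormedSpace ℝ V]

/-- Alternating maps on a finite-dimensional space can be recovered linearly from their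
values on finitely many tuples. -/
theorem exists_reconstruction {ι : Type*} [Fintype ι] [DecidableEq ι] {κ : Type*} [Fintype κ]
    (b : Module.Basis κ ℝ V) :
    ∃ P : ((ι → κ) → ℝ) →L[ℝ] (V [⋀^ι]→L[ℝ] ℝ),
      ∀ A : V [⋀^ι]→L[ℝ] ℝ, P (fun i => A fun a => b (i a)) = A := by
  let T : (V [⋀^ι]→L[ℝ] ℝ) →ₗ[ℝ] ((ι → κ) → ℝ) :=
    { toFun := fun A i => A fun a => b (i a)
      map_add' := fun _ _ => rfl
      map_smul' := fun _ _ => rfl }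
  have hT : LinearMap.ker T = ⊥ := by
    rw [LinearMap.ker_eq_bot]
    intro A B hAB
    apply ContinuousAlternatingMap.toAlternatingMap_injective
    exact Module.Basis.ext_alternating b fun i _ => congrFun hAB i
  -- Evaluation on basis tuples is injective; its left inverse starts from a finite-dimensional
  -- space, hence is continuous.
  obtain ⟨P, hP⟩ := T.exists_leftInverse_of_injective hT
  exact ⟨LinearMap.toContinuousLinearMap P, fun A => LinearMap.congr_fun hP A⟩

variable [FiniteDimensional ℝ V] {W : Type*} [NormedAddCommGroup W] [NormedSpace ℝ W]

theorem contDiffOn_alternating_iff {ι : Type*} [Fintype ι] [DecidableEq ι] {n : ℕ∞ω} {s : Set W}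
    {A : W → V [⋀^ι]→L[ℝ] ℝ} :
    ContDiffOn ℝ n A s ↔ ∀ v : ι → V, ContDiffOn ℝ n (fun z => A z v) s := by
  constructor
  · intro h v
    exact (ContinuousAlternatingMap.apply ℝ V ℝ v).contDiff.comp_contDiffOn h
  · intro h
    obtain ⟨P, hP⟩ := exists_reconstruction (ι := ι) (Module.finBasis ℝ V)
    have h1 : A = fun z => P fun i => A z fun a => Module.finBasis ℝ V (i a) :=
      funext fun z => (hP (A z)).symm
    rw [h1]
    exact P.contDiff.comp_contDiffOn (contDiffOn_pi.2 fun i => h _)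

/-- Expanding the moving arguments in a basis makes the value a polynomial in their coordinates and
in the values of `A` on fixed tuples. -/
theorem contDiffOn_alternating_apply {ι : Type*} [Fintype ι] [DecidableEq ι] {n : ℕ∞ω} {s : Set W}
    {A : W → V [⋀^ι]→L[ℝ] ℝ} {v : ι → W → V} (hA : ContDiffOn ℝ n A s)
    (hv : ∀ i, ContDiffOn ℝ n (v i) s) :
    ContDiffOn ℝ n (fun z => A z fun i => v i z) s := by
  set b := Module.finBasis ℝ V
  have h1 : (fun z => A z fun i => v i z) = fun z => ∑ r : ι → Fin (Module.finrank ℝ V),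
      (∏ i, b.repr (v i z) (r i)) * A z fun i => b (r i) := by
    funext z
    have h2 : (fun i => v i z) = fun i => ∑ k, b.repr (v i z) k • b k :=
      funext fun i => (b.sum_repr (v i z)).symm
    conv_lhs => rw [h2]
    have := (A z).toMultilinearMap.map_sum (fun i k => b.repr (v i z) k • b k)
    refine this.trans (Finset.sum_congr rfl fun r _ => ?_)
    exact (A z).toMultilinearMap.map_smul_univ (fun i => b.repr (v i z) (r i)) fun i => b (r i)
  rw [h1]
  refine ContDiffOn.sum fun r _ => ContDiffOn.mul (contDiffOn_prod fun i _ => ?_)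
    (contDiffOn_alternating_iff.1 hA _)
  exact (LinearMap.toContinuousLinearMap
    ((LinearMap.proj (r i)).comp b.equivFun.toLinearMap)).contDiff.comp_contDiffOn (hv i)

theorem contDiffOn_alternating_comp {V' : Type*} [NormedAddCommGroup V'] [NormedSpace ℝ V']
    [FiniteDimensional ℝ V'] {ι : Type*} [Fintype ι] [DecidableEq ι] {n : ℕ∞ω} {s : Set W}
    {A : W → V [⋀^ι]→L[ℝ] ℝ} {L : W → V' →L[ℝ] V} (hA : ContDiffOn ℝ n A s)
    (hL : ∀ v, ContDiffOn ℝ n (fun z => L z v) s) :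
    ContDiffOn ℝ n (fun z => (A z).compContinuousLinearMap (L z)) s := by
  rw [contDiffOn_alternating_iff]
  intro v
  exact contDiffOn_alternating_apply (v := fun i z => L z (v i)) hA fun i => hL (v i)

/-- A family of alternating maps on a punctured neighbourhood, all of whose values extend
smoothly, extends smoothly. -/
theorem exists_contDiff_alternating_extension {ι : Type*} [Fintype ι] [DecidableEq ι] {s : Set W}
    {A : W → V [⋀^ι]→L[ℝ] ℝ} (S : (ι → V) → W → ℝ) (hS : ∀ v, ContDiff ℝ ∞ (S v))
    (hAS : ∀ v, ∀ z ∈ s, A z v = S v z) :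
    ∃ B : W → V [⋀^ι]→L[ℝ] ℝ, ContDiff ℝ ∞ B ∧ ∀ z ∈ s, B z = A z := by
  obtain ⟨P, hP⟩ := exists_reconstruction (ι := ι) (Module.finBasis ℝ V)
  refine ⟨fun z => P fun i => S (fun a => Module.finBasis ℝ V (i a)) z,
    P.contDiff.comp (contDiff_pi.2 fun i => hS _), fun z hz => ?_⟩
  exact (congrArg P (funext fun i => (hAS _ z hz).symm)).trans (hP (A z))

end Alternating

end NPExtension

namespace NPExtension

/-! ### The standard form on basis vectors -/

theorem wedge3_apply (i j k : Fin 7) (c : Fin 3 → Fin 7 → ℝ) :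
    wedge3 i j k c = c 0 i * c 1 j * c 2 k - c 0 i * c 1 k * c 2 j - c 0 j * c 1 i * c 2 k
      + c 0 j * c 1 k * c 2 i + c 0 k * c 1 i * c 2 j - c 0 k * c 1 j * c 2 i := by
  simp [wedge3, Matrix.det_fin_three]

/-- The value of `e^i ∧ e^j ∧ e^k` on the basis vectors with indices `a, b, c`. -/
def wedge3Int (i j k a b c : Fin 7) : ℤ :=
  if a = i then if b = j then if c = k then 1 else 0 else
    if b = k then if c = j then -1 else 0 else 0
  else if a = j then if b = k then if c = i then 1 else 0 else
    if b = i then if c = k then -1 else 0 else 0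
  else if a = k then if b = i then if c = j then 1 else 0 else
    if b = j then if c = i then -1 else 0 else 0
  else 0

/-- The structure constants of the standard form. -/
def phiStdInt (a b c : Fin 7) : ℤ :=
  wedge3Int 0 1 2 a b c + wedge3Int 0 3 4 a b c + wedge3Int 0 5 6 a b c + wedge3Int 1 3 5 a b c
    - wedge3Int 1 4 6 a b c - wedge3Int 2 3 6 a b c - wedge3Int 2 4 5 a b c

theorem wedge3_single {i j k : Fin 7} (hij : i ≠ j) (hik : i ≠ k) (hjk : j ≠ k)
    (t : Fin 3 → Fin 7) :
    wedge3 i j k (fun a m => if t a = m then 1 else 0) =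
      (wedge3Int i j k (t 0) (t 1) (t 2) : ℝ) := by
  have hij' := hij.symm
  have hik' := hik.symm
  have hjk' := hjk.symm
  rw [wedge3_apply]
  generalize t 0 = a
  generalize t 1 = b
  generalize t 2 = c
  unfold wedge3Int
  by_cases h1 : a = i
  · subst h1
    by_cases h2 : b = j
    · subst h2
      by_cases h3 : c = k <;> simp_all
    · by_cases h3 : b = k
      · subst h3
        by_cases h4 : c = j <;> simp_all
      · simp_all
  · by_cases h2 : a = j
    · subst h2
      by_cases h3 : b = k
      · subst h3
        by_cases h4 : c = i <;> simp_all
      · by_cases h4 : b = i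
        · subst h4
          by_cases h5 : c = k <;> simp_all
        · simp_all
    · by_cases h3 : a = k
      · subst h3
        by_cases h4 : b = i
        · subst h4
          by_cases h5 : c = j <;> simp_all
        · by_cases h5 : b = j
          · subst h5
            by_cases h6 : c = i <;> simp_all
          · simp_all
      · simp_all

theorem phiStd_single (t : Fin 3 → Fin 7) :
    phiStd (fun a m => if t a = m then 1 else 0) = (phiStdInt (t 0) (t 1) (t 2) : ℝ) := by
  simp only [phiStd, phiStdInt]
  push_cast
  repeat rw [wedge3_single (by decide) (by decide) (by decide)]

/-! ### Signs of permutations and the Fano plane -/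

/-- The sign contributed by a pair of values of a permutation. -/
def inversionSign (a b : Fin 7) : ℤ := if a < b then 1 else -1

/-- The sign of the permutation with values `a, …, g`. -/
def signInt (a b c d e f g : Fin 7) : ℤ :=
  inversionSign a b * (inversionSign a c * inversionSign b c) *
  (inversionSign a d * inversionSign b d * inversionSign c d) *
  (inversionSign a e * inversionSign b e * inversionSign c e * inversionSign d e) *
  (inversionSign a f * inversionSign b f * inversionSign c f * inversionSign d f *
    inversionSign e f) *
  (inversionSign a g * inversionSign b g * inversionSign c g * inversionSign d g *
    inversionSign e g * inversionSign f g)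

/-- Counting inversions makes the sign a function of the seven values, which a finite check can
evaluate without enumerating permutations. -/
theorem sign_eq_signInt (σ : Equiv.Perm (Fin 7)) :
    (Equiv.Perm.sign σ : ℤ) = signInt (σ 0) (σ 1) (σ 2) (σ 3) (σ 4) (σ 5) (σ 6) := by
  have h : ∀ a b : Fin 7, (((if a < b then 1 else -1 : ℤˣ)) : ℤ) = inversionSign a b := by
    intro a b
    unfold inversionSign
    split_ifs <;> simp
  have h2 : ∀ j : Fin 7, Finset.Iio j = (Finset.univ.filter (· < j)) := by intro j; ext; simp
  rw [Equiv.Perm.sign_eq_prod_prod_Iio]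
  push_cast
  simp only [h, h2, Finset.prod_filter]
  simp only [Fin.prod_univ_succ, signInt]
  simp
  ring

/-- The points of the Fano plane whose lines are the triples occurring in the standard form. -/
def fanoVector : Fin 7 → ZMod 2 × ZMod 2 × ZMod 2 :=
  ![(1, 0, 0), (0, 1, 0), (1, 1, 0), (0, 0, 1), (1, 0, 1), (0, 1, 1), (1, 1, 1)]

theorem fanoVector_eq_of_add_eq_zero : ∀ a b : Fin 7, fanoVector a + fanoVector b = 0 → a = b := by
  decide +kernel

theorem fanoVector_add_eq_zero : ∀ a b c : Fin 7, phiStdInt a b c ≠ 0 →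
    fanoVector a + fanoVector b + fanoVector c = 0 := by
  decide +kernel

/-- The Fano labels are the binary digits of `1, …, 7`, so two points of a line determine the third.
This prunes the enumeration that follows. -/
theorem xor_of_phiStdInt_ne_zero : ∀ a b c : Fin 7, phiStdInt a b c ≠ 0 →
    (a.val + 1) ^^^ (b.val + 1) = c.val + 1 := by
  decide +kernel

-- All nonzero summands of the diagonal entry `β(e_i, e_i)` have the same sign, so nothing cancels.
-- The line conditions are placed as early as possible among the quantifiers to keep the search
-- small.
set_option maxRecDepth 100000 in
set_option synthInstance.maxSize 20000 in
set_option synthInstance.maxHeartbeats 400000 in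
theorem signInt_mul_phiStdInt_pos :
    ∀ i a b : Fin 7, (i.val + 1) ^^^ (a.val + 1) = b.val + 1 →
    ∀ c : Fin 7, (c ≠ a ∧ c ≠ b) → ∀ d, (i.val + 1) ^^^ (c.val + 1) = d.val + 1 →
    ∀ e, (e ≠ a ∧ e ≠ b ∧ e ≠ c ∧ e ≠ d) → ∀ f, (f ≠ a ∧ f ≠ b ∧ f ≠ c ∧ f ≠ d) →
    ∀ g, (e.val + 1) ^^^ (f.val + 1) = g.val + 1 → (g ≠ a ∧ g ≠ b ∧ g ≠ c ∧ g ≠ d) →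
    0 < signInt a b c d e f g * (phiStdInt i a b * phiStdInt i c d * phiStdInt e f g) := by
  decide +kernel

/-- The summand of `β(e_i, e_j)` for the standard form belonging to the permutation `σ`. -/
def betaTerm (i j : Fin 7) (σ : Equiv.Perm (Fin 7)) : ℤ :=
  (Equiv.Perm.sign σ : ℤ) * (phiStdInt i (σ 0) (σ 1) * phiStdInt j (σ 2) (σ 3) *
    phiStdInt (σ 4) (σ 5) (σ 6))

/-- The points of a line sum to zero over `𝔽₂`, and so do all seven points. If the three factors are
nonzero, adding their lines and removing the seven values of `σ` leaves `i + j = 0`, hence `i = j`.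
-/
theorem betaTerm_eq_zero {i j : Fin 7} (hij : i ≠ j) (σ : Equiv.Perm (Fin 7)) :
    betaTerm i j σ = 0 := by
  by_contra h
  simp only [betaTerm, mul_eq_zero, not_or] at h
  obtain ⟨-, ⟨h1, h2⟩, h3⟩ := h
  have h4 : ∑ k, fanoVector (σ k) = 0 :=
    (Equiv.sum_comp σ fanoVector).trans (by decide +kernel)
  simp only [Fin.sum_univ_seven] at h4
  refine hij (fanoVector_eq_of_add_eq_zero i j ?_)
  have e1 := fanoVector_add_eq_zero _ _ _ h1
  have e2 := fanoVector_add_eq_zero _ _ _ h2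
  have e3 := fanoVector_add_eq_zero _ _ _ h3
  calc fanoVector i + fanoVector j
      = (fanoVector i + fanoVector (σ 0) + fanoVector (σ 1))
        + (fanoVector j + fanoVector (σ 2) + fanoVector (σ 3))
        + (fanoVector (σ 4) + fanoVector (σ 5) + fanoVector (σ 6))
        - (fanoVector (σ 0) + fanoVector (σ 1) + fanoVector (σ 2) + fanoVector (σ 3)
          + fanoVector (σ 4) + fanoVector (σ 5) + fanoVector (σ 6)) := by abel
    _ = 0 := by rw [e1, e2, e3, h4]; simp

theorem betaTerm_nonneg (i : Fin 7) (σ : Equiv.Perm (Fin 7)) : 0 ≤ betaTerm i i σ := by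
  by_cases h : betaTerm i i σ = 0
  · exact h.ge
  have h' := h
  simp only [betaTerm, mul_eq_zero, not_or] at h'
  obtain ⟨-, ⟨h1, h2⟩, h3⟩ := h'
  rw [betaTerm, sign_eq_signInt]
  have hne : ∀ {a b : Fin 7}, a ≠ b → σ a ≠ σ b := fun hab => σ.injective.ne hab
  exact (signInt_mul_phiStdInt_pos i _ _ (xor_of_phiStdInt_ne_zero _ _ _ h1) _
    ⟨hne (by decide), hne (by decide)⟩ _ (xor_of_phiStdInt_ne_zero _ _ _ h2) _
    ⟨hne (by decide), hne (by decide), hne (by decide), hne (by decide)⟩ _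
    ⟨hne (by decide), hne (by decide), hne (by decide), hne (by decide)⟩ _
    (xor_of_phiStdInt_ne_zero _ _ _ h3)
    ⟨hne (by decide), hne (by decide), hne (by decide), hne (by decide)⟩).le

/-- For each `i`, an enumeration `a, …, g` of the indices such that `i a b`, `i c d` and `e f g`
are lines. -/
def fanoFlag : Fin 7 → Fin 7 → Fin 7 :=
  ![![1, 2, 3, 4, 0, 5, 6], ![0, 2, 3, 5, 1, 4, 6], ![0, 1, 3, 6, 2, 4, 5],
    ![0, 4, 1, 5, 3, 2, 6], ![0, 3, 1, 6, 4, 2, 5], ![0, 6, 1, 3, 5, 2, 4],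
    ![0, 5, 1, 4, 6, 2, 3]]

theorem fanoFlag_injective (i : Fin 7) : Function.Injective (fanoFlag i) := by
  revert i
  decide +kernel

theorem phiStdInt_fanoFlag (i : Fin 7) :
    phiStdInt i (fanoFlag i 0) (fanoFlag i 1) * phiStdInt i (fanoFlag i 2) (fanoFlag i 3) *
      phiStdInt (fanoFlag i 4) (fanoFlag i 5) (fanoFlag i 6) ≠ 0 := by
  revert i
  decide +kernel

theorem sum_betaTerm_pos (i : Fin 7) : 0 < ∑ σ, betaTerm i i σ := by
  let σ : Equiv.Perm (Fin 7) := Equiv.ofBijective (fanoFlag i)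
    (Finite.injective_iff_bijective.1 (fanoFlag_injective i))
  refine Finset.sum_pos' (fun σ _ => betaTerm_nonneg i σ) ⟨σ, Finset.mem_univ _, ?_⟩
  refine lt_of_le_of_ne (betaTerm_nonneg i σ) (Ne.symm ?_)
  exact mul_ne_zero (by simp) (phiStdInt_fanoFlag i)

/-! ### The bilinear form of a positive form -/

theorem mul_alternatization_basis {ι : Type} {V : Type*} [Fintype ι] [DecidableEq ι]
    [AddCommGroup V] [Module ℝ V] (F : MultilinearMap ℝ (fun _ : ι => V) ℝ) (u v : Module.Basis ι ℝ V) (r : ℝ) :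
    r * MultilinearMap.alternatization F v =
      u.det v * (r * MultilinearMap.alternatization F u) := by
  have h := congrArg (fun B : V [⋀^ι]→ₗ[ℝ] ℝ => B v)
    ((MultilinearMap.alternatization F).eq_smul_basis_det u)
  simp only [AlternatingMap.smul_apply, smul_eq_mul] at h
  rw [h]
  ring

section Beta

variable {V : Type*} [AddCommGroup V] [Module ℝ V] [TopologicalSpace V]

theorem IsPositive.exists_basis {φ : V [⋀^Fin 3]→L[ℝ] ℝ} (hφ : IsPositive φ) :
    ∃ u : Module.Basis (Fin 7) ℝ V, (∀ w, φ w = phiStd fun a i => u.repr (w a) i) ∧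
      ∀ i j k, φ ![u i, u j, u k] = (phiStdInt i j k : ℝ) := by
  obtain ⟨u, hu⟩ := hφ
  refine ⟨u, hu, fun i j k => ?_⟩
  rw [hu]
  refine Eq.trans ?_ (phiStd_single ![i, j, k])
  congr 1
  funext a m
  fin_cases a <;> simp [Finsupp.single_apply] <;> split_ifs <;> simp_all

variable (φ : V [⋀^Fin 3]→L[ℝ] ℝ)

theorem map_add_zero (x x' y z : V) : φ ![x + x', y, z] = φ ![x, y, z] + φ ![x', y, z] :=
  φ.toAlternatingMap.map_vecCons_add ..

theorem map_smul_zero (r : ℝ) (x y z : V) : φ ![r • x, y, z] = r * φ ![x, y, z] :=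
  φ.toAlternatingMap.map_vecCons_smul ..

theorem map_add_one (x y y' z : V) : φ ![x, y + y', z] = φ ![x, y, z] + φ ![x, y', z] := by
  have h := φ.map_update_add ![x, y, z] 1 y y'
  have e : ∀ t, Function.update ![x, y, z] 1 t = ![x, t, z] := fun t => by
    ext i; fin_cases i <;> simp
  simpa only [e] using h

theorem map_smul_one (r : ℝ) (x y z : V) : φ ![x, r • y, z] = r * φ ![x, y, z] := by
  have h := φ.map_update_smul ![x, y, z] 1 r y
  have e : ∀ t, Function.update ![x, y, z] 1 t = ![x, t, z] := fun t => by
    ext i; fin_cases i <;> simp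
  simpa only [e, smul_eq_mul] using h

theorem map_add_two (x y z z' : V) : φ ![x, y, z + z'] = φ ![x, y, z] + φ ![x, y, z'] := by
  have h := φ.map_update_add ![x, y, z] 2 z z'
  have e : ∀ t, Function.update ![x, y, z] 2 t = ![x, y, t] := fun t => by
    ext i; fin_cases i <;> simp
  simpa only [e] using h

theorem map_smul_two (r : ℝ) (x y z : V) : φ ![x, y, r • z] = r * φ ![x, y, z] := by
  have h := φ.map_update_smul ![x, y, z] 2 r z
  have e : ∀ t, Function.update ![x, y, z] 2 t = ![x, y, t] := fun t => by
    ext i; fin_cases i <;> simp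
  simpa only [e, smul_eq_mul] using h

/-- The multilinear map `ι_x φ ⊗ ι_y φ ⊗ φ`. -/
def contractionProduct (x y : V) : MultilinearMap ℝ (fun _ : Fin 7 => V) ℝ where
  toFun w := φ ![x, w 0, w 1] * φ ![y, w 2, w 3] * φ ![w 4, w 5, w 6]
  map_update_add' := by
    intro inst m i p q
    obtain rfl : inst = instDecidableEqFin 7 := Subsingleton.elim _ _
    fin_cases i <;>
    simp [map_add_zero, map_add_one, map_add_two] <;> ring
  map_update_smul' := by
    intro inst m i p q
    obtain rfl : inst = instDecidableEqFin 7 := Subsingleton.elim _ _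
    fin_cases i <;>
    simp [map_smul_zero, map_smul_one, map_smul_two] <;> ring

/-- This exhibits `β(x, y)` as a form of top degree evaluated on `v`, so a change of basis only
multiplies it by a determinant. The constant is `1/6 · 1/24`. -/
theorem beta_eq_alternatization (v : Module.Basis (Fin 7) ℝ V) (x y : V) :
    beta v φ x y = (1 / 144) * MultilinearMap.alternatization (contractionProduct φ x y) v := by
  rw [MultilinearMap.alternatization_apply, beta, ← mul_assoc]
  congr 1
  · norm_num
  · refine Finset.sum_congr rfl fun σ _ => ?_
    rw [Units.smul_def, zsmul_eq_mul]
    rfl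

theorem beta_change_basis (u v : Module.Basis (Fin 7) ℝ V) (x y : V) :
    beta v φ x y = u.det v * beta u φ x y := by
  rw [beta_eq_alternatization φ v, beta_eq_alternatization φ u]
  have h := mul_alternatization_basis (contractionProduct φ x y) u v (1 / 144)
  exact h

/-- `β_φ` as a bilinear form. -/
noncomputable def betaBilin (v : Module.Basis (Fin 7) ℝ V) : LinearMap.BilinForm ℝ V :=
  LinearMap.mk₂ ℝ (beta v φ)
    (fun x x' y => by
      simp only [beta, map_add_zero, ← mul_add, ← Finset.sum_add_distrib]
      congr 2; exact Finset.sum_congr rfl fun σ _ => by ring)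
    (fun r x y => by
      simp only [beta, map_smul_zero, smul_eq_mul, Finset.mul_sum]
      exact Finset.sum_congr rfl fun σ _ => by ring)
    (fun x y y' => by
      simp only [beta, map_add_zero, ← mul_add, ← Finset.sum_add_distrib]
      congr 2; exact Finset.sum_congr rfl fun σ _ => by ring)
    (fun r x y => by
      simp only [beta, map_smul_zero, smul_eq_mul, Finset.mul_sum]
      exact Finset.sum_congr rfl fun σ _ => by ring)

/-- In an adapted basis the matrix is diagonal with positive entries. Another basis changes it by a
congruence and a nonzero determinant factor. -/
theorem IsPositive.det_betaMatrix_ne_zero {φ : V [⋀^Fin 3]→L[ℝ] ℝ} (hφ : IsPositive φ)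
    (v : Module.Basis (Fin 7) ℝ V) : (betaMatrix v φ).det ≠ 0 := by
  obtain ⟨u, -, hu⟩ := hφ.exists_basis
  have hβ : ∀ i j, beta u φ (u i) (u j) = (1 / 144) * ((∑ σ, betaTerm i j σ : ℤ) : ℝ) := by
    intro i j
    rw [beta, ← mul_assoc]
    congr 1
    · norm_num
    · push_cast
      refine Finset.sum_congr rfl fun σ _ => ?_
      simp only [hu, betaTerm]
      push_cast
      rfl
  have hdiag : LinearMap.BilinForm.toMatrix u (betaBilin φ u) =
      Matrix.diagonal fun i => (1 / 144) * ((∑ σ, betaTerm i i σ : ℤ) : ℝ) := by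
    ext i j
    rw [LinearMap.BilinForm.toMatrix_apply, Matrix.diagonal_apply]
    change beta u φ (u i) (u j) = _
    rw [hβ]
    split_ifs with hij
    · rw [hij]
    · simp [betaTerm_eq_zero hij]
  have hnd : (betaBilin φ u).Nondegenerate := by
    rw [LinearMap.BilinForm.nondegenerate_iff_det_ne_zero u, hdiag, Matrix.det_diagonal]
    refine Finset.prod_ne_zero_iff.2 fun i _ => mul_ne_zero (by norm_num) ?_
    exact_mod_cast (sum_betaTerm_pos i).ne'
  have hv : betaMatrix v φ = u.det v • LinearMap.BilinForm.toMatrix v (betaBilin φ u) := by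
    ext i j
    rw [Matrix.smul_apply, LinearMap.BilinForm.toMatrix_apply]
    exact beta_change_basis φ u v _ _
  rw [hv, Matrix.det_smul]
  exact mul_ne_zero (pow_ne_zero _ (u.isUnit_det v).ne_zero)
    ((LinearMap.BilinForm.nondegenerate_iff_det_ne_zero v).1 hnd)

end Beta

/-! ### Continuity of the Hodge dual -/

section Continuity

variable {V : Type*} [NormedAddCommGroup V] [NormedSpace ℝ V]

theorem continuousAt_ninthRoot {x : ℝ} (hx : x ≠ 0) : ContinuousAt ninthRoot x := by
  have h1 : ContinuousAt (fun x : ℝ => |x| ^ (1 / 9 : ℝ)) x :=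
    (continuous_abs.continuousAt).rpow_const (Or.inr (by norm_num))
  have h2 : ContinuousAt Real.sign x := by
    rcases lt_or_gt_of_ne hx with h | h
    · exact continuousAt_const.congr
        (Filter.eventuallyEq_of_mem (Iio_mem_nhds h) fun y hy => (Real.sign_of_neg hy).symm)
    · exact continuousAt_const.congr
        (Filter.eventuallyEq_of_mem (Ioi_mem_nhds h) fun y hy => (Real.sign_of_pos hy).symm)
  exact h2.mul h1

theorem ninthRoot_ne_zero {x : ℝ} (hx : x ≠ 0) : ninthRoot x ≠ 0 := by
  refine mul_ne_zero ?_ (Real.rpow_pos_of_pos (abs_pos.2 hx) _).ne'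
  rcases lt_or_gt_of_ne hx with h | h
  · rw [Real.sign_of_neg h]; norm_num
  · rw [Real.sign_of_pos h]; norm_num

variable {X : Type*} [TopologicalSpace X]

theorem continuousAt_matrix_det {n : Type*} [Fintype n] [DecidableEq n] {B : X → Matrix n n ℝ}
    {x : X} (hB : ContinuousAt B x) : ContinuousAt (fun z => (B z).det) x :=
  (continuous_id.matrix_det.continuousAt).comp hB

theorem continuousAt_matrix_adjugate {n : Type*} [Fintype n] [DecidableEq n]
    {B : X → Matrix n n ℝ} {x : X} (hB : ContinuousAt B x) :
    ContinuousAt (fun z => (B z).adjugate) x :=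
  (continuous_id.matrix_adjugate.continuousAt).comp hB

/-- The Hodge dual is built from the values of the form by polynomials, the ninth root of `det B`,
and division by that root and by `det g`; all are continuous where `det B ≠ 0`. -/
theorem continuousAt_hodgeDual {A : X → V [⋀^Fin 3]→L[ℝ] ℝ} {x : X} (hA : ContinuousAt A x)
    (v : Module.Basis (Fin 7) ℝ V) (w : Fin 4 → V) (hdet : (betaMatrix v (A x)).det ≠ 0) :
    ContinuousAt (fun z => hodgeDual v (A z) w) x := by
  have happ : ∀ y : Fin 3 → V, ContinuousAt (fun z => A z y) x := fun y =>
    ((ContinuousAlternatingMap.apply ℝ V ℝ y).continuous.continuousAt).comp hA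
  have hB : ContinuousAt (fun z => betaMatrix v (A z)) x := by
    refine continuousAt_pi.2 fun i => continuousAt_pi.2 fun j => ?_
    simp only [betaMatrix, Matrix.of_apply, beta]
    refine continuousAt_const.mul (continuousAt_const.mul ?_)
    refine tendsto_finsetSum _ fun σ _ => ?_
    exact continuousAt_const.mul (((happ _).mul (happ _)).mul (happ _))
  have hD : ContinuousAt (fun z => (betaMatrix v (A z)).det) x := continuousAt_matrix_det hB
  have hr : ContinuousAt (fun z => ninthRoot (betaMatrix v (A z)).det) x :=
    (continuousAt_ninthRoot hdet).comp (f := fun z => (betaMatrix v (A z)).det) hD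
  have hr0 := ninthRoot_ne_zero hdet
  have hg : ContinuousAt (fun z => gMatrix v (A z)) x := (hr.inv₀ hr0).smul hB
  have hgd : (gMatrix v (A x)).det ≠ 0 := by
    rw [gMatrix, Matrix.det_smul]
    exact mul_ne_zero (pow_ne_zero _ (inv_ne_zero hr0)) hdet
  have hgi : ContinuousAt (fun z => (gMatrix v (A z))⁻¹) x := by
    simp only [Matrix.inv_def, Ring.inverse_eq_inv']
    exact ((continuousAt_matrix_det hg).inv₀ hgd).smul (continuousAt_matrix_adjugate hg)
  have hgi' : ∀ i j, ContinuousAt (fun z => (gMatrix v (A z))⁻¹ i j) x := fun i j =>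
    continuousAt_pi.1 (continuousAt_pi.1 hgi i) j
  unfold hodgeDual volForm
  refine continuousAt_const.mul (tendsto_finsetSum _ fun i _ => tendsto_finsetSum _ fun j _ => ?_)
  exact ((tendsto_finsetProd _ fun a _ => hgi' _ _).mul (happ _)).mul (hr.mul continuousAt_const)

end Continuity

end NPExtension

namespace NPExtension

/-! ### Nondegeneracy and sign of positive forms -/

section Nondegenerate

/-- Sorting by the last argument displays the seven components of the cross product of the first
two. -/
theorem phiStd_apply (c : Fin 3 → Fin 7 → ℝ) :
    phiStd c =
      (c 0 1 * c 1 2 - c 0 2 * c 1 1 + c 0 3 * c 1 4 - c 0 4 * c 1 3 + c 0 5 * c 1 6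
        - c 0 6 * c 1 5) * c 2 0
      + (c 0 2 * c 1 0 - c 0 0 * c 1 2 + c 0 3 * c 1 5 - c 0 5 * c 1 3 - c 0 4 * c 1 6
        + c 0 6 * c 1 4) * c 2 1
      + (c 0 0 * c 1 1 - c 0 1 * c 1 0 - c 0 3 * c 1 6 + c 0 6 * c 1 3 - c 0 4 * c 1 5
        + c 0 5 * c 1 4) * c 2 2
      + (c 0 4 * c 1 0 - c 0 0 * c 1 4 + c 0 5 * c 1 1 - c 0 1 * c 1 5 - c 0 6 * c 1 2
        + c 0 2 * c 1 6) * c 2 3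
      + (c 0 0 * c 1 3 - c 0 3 * c 1 0 - c 0 6 * c 1 1 + c 0 1 * c 1 6 - c 0 5 * c 1 2
        + c 0 2 * c 1 5) * c 2 4
      + (c 0 6 * c 1 0 - c 0 0 * c 1 6 + c 0 1 * c 1 3 - c 0 3 * c 1 1 - c 0 2 * c 1 4
        + c 0 4 * c 1 2) * c 2 5
      + (c 0 0 * c 1 5 - c 0 5 * c 1 0 - c 0 1 * c 1 4 + c 0 4 * c 1 1 - c 0 2 * c 1 3
        + c 0 3 * c 1 2) * c 2 6 := by
  simp only [phiStd, wedge3_apply]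
  ring

variable {V : Type*} [AddCommGroup V] [Module ℝ V] [TopologicalSpace V]
  {φ : V [⋀^Fin 3]→L[ℝ] ℝ}

/-- The cross product of a `G₂`-structure vanishes only on linearly dependent pairs. -/
theorem cross_nondegenerate (a b : Fin 7 → ℝ) (ha : a ≠ 0)
    (h : ∀ z, phiStd ![a, b, z] = 0) : ∃ r : ℝ, b = r • a := by
  have h0 := h (Pi.single 0 1)
  have h1 := h (Pi.single 1 1)
  have h2 := h (Pi.single 2 1)
  have h3 := h (Pi.single 3 1)
  have h4 := h (Pi.single 4 1)
  have h5 := h (Pi.single 5 1)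
  have h6 := h (Pi.single 6 1)
  simp only [phiStd_apply, Matrix.cons_val] at h0 h1 h2 h3 h4 h5 h6
  simp at h0 h1 h2 h3 h4 h5 h6
  set N := ∑ i, a i ^ 2 with hN
  set D := ∑ i, a i * b i with hD
  have hNpos : 0 < N := by
    obtain ⟨i, hi⟩ := Function.ne_iff.1 ha
    exact Finset.sum_pos' (fun i _ => sq_nonneg _) ⟨i, Finset.mem_univ _, by
      have : a i ≠ 0 := hi
      positivity⟩
  have hsum : ∑ i, (N * b i - D * a i) ^ 2 = 0 := by
    -- This is `|a × b|² = |a|²|b|² - ⟨a, b⟩²`: each vanishing component of `a × b` is multiplied by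
    -- itself and the products are added.
    have key : N * (∑ i, b i ^ 2) - D ^ 2 = 0 := by
      simp only [hN, hD, Fin.sum_univ_seven]
      linear_combination
        (a 1 * b 2 - a 2 * b 1 + a 3 * b 4 - a 4 * b 3 + a 5 * b 6 - a 6 * b 5) * h0
        + (a 2 * b 0 - a 0 * b 2 + a 3 * b 5 - a 5 * b 3 - a 4 * b 6 + a 6 * b 4) * h1
        + (a 0 * b 1 - a 1 * b 0 - a 3 * b 6 + a 6 * b 3 - a 4 * b 5 + a 5 * b 4) * h2
        + (a 4 * b 0 - a 0 * b 4 + a 5 * b 1 - a 1 * b 5 - a 6 * b 2 + a 2 * b 6) * h3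
        + (a 0 * b 3 - a 3 * b 0 - a 6 * b 1 + a 1 * b 6 - a 5 * b 2 + a 2 * b 5) * h4
        + (a 6 * b 0 - a 0 * b 6 + a 1 * b 3 - a 3 * b 1 - a 2 * b 4 + a 4 * b 2) * h5
        + (a 0 * b 5 - a 5 * b 0 - a 1 * b 4 + a 4 * b 1 - a 2 * b 3 + a 3 * b 2) * h6
    have e : ∑ i, (N * b i - D * a i) ^ 2 = N * (N * (∑ i, b i ^ 2) - D ^ 2) := by
      have e1 : ∀ i, (N * b i - D * a i) ^ 2 =
          N ^ 2 * b i ^ 2 - 2 * N * D * (a i * b i) + D ^ 2 * a i ^ 2 := fun i => by ring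
      simp only [e1, Finset.sum_add_distrib, Finset.sum_sub_distrib, ← Finset.mul_sum]
      rw [← hN, ← hD]
      ring
    rw [e, key, mul_zero]
  refine ⟨D / N, funext fun i => ?_⟩
  have hi := (Finset.sum_eq_zero_iff_of_nonneg fun i _ => sq_nonneg _).1 hsum i (Finset.mem_univ _)
  have hi' := pow_eq_zero_iff (two_ne_zero) |>.1 hi
  rw [Pi.smul_apply, smul_eq_mul]
  field_simp
  linarith

theorem IsPositive.exists_eq_smul (hφ : IsPositive φ) {x y : V} (hx : x ≠ 0)
    (h : ∀ z, φ ![x, y, z] = 0) : ∃ r : ℝ, y = r • x := by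
  obtain ⟨u, hu⟩ := hφ
  have ha : u.equivFun x ≠ 0 := by simpa using hx
  obtain ⟨r, hr⟩ := cross_nondegenerate (u.equivFun x) (u.equivFun y) ha fun z => by
    have := h (u.equivFun.symm z)
    rw [hu] at this
    rw [← this]
    congr 1
    funext a
    fin_cases a
    · rfl
    · rfl
    · exact (u.equivFun.apply_symm_apply z).symm
  exact ⟨r, u.equivFun.injective (by rw [hr, map_smul])⟩

/-- A positive form of the shape `phiInv` satisfies `f₂ f₃ ≤ f₄²`. -/
theorem IsPositive.phiInv_le (hφ : IsPositive φ) {e : Fin 7 → V}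
    (he : LinearIndependent ℝ e) (hs : ∀ z : V, ∃ c : Fin 7 → ℝ, z = ∑ i, c i • e i)
    {f : Fin 5 → ℝ} (h : ∀ c : Fin 3 → Fin 7 → ℝ, φ (fun a => ∑ i, c a i • e i) = phiInv f c) :
    f 2 * f 3 ≤ f 4 ^ 2 := by
  have key : ∀ a b : Fin 7 → ℝ, a ≠ 0 → (∀ z, phiInv f ![a, b, z] = 0) →
      ∃ r : ℝ, b = r • a := by
    intro a b ha hab
    have hx : ∑ i, a i • e i ≠ 0 := fun h0 =>
      ha (funext fun i => Fintype.linearIndependent_iff.1 he a h0 i)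
    obtain ⟨r, hr⟩ := hφ.exists_eq_smul hx (y := ∑ i, b i • e i) fun z => by
      obtain ⟨c, rfl⟩ := hs z
      rw [← hab c, ← h]
      congr 1
      funext k
      fin_cases k <;> rfl
    refine ⟨r, funext fun i => ?_⟩
    have h1 : ∑ i, (b i - r * a i) • e i = 0 := by
      simp only [sub_smul, Finset.sum_sub_distrib, mul_smul, ← Finset.smul_sum]
      rw [hr, sub_self]
    have := Fintype.linearIndependent_iff.1 he _ h1 i
    simp only [Pi.smul_apply, smul_eq_mul]
    linarith
  by_contra! hlt
  -- Only `f₀` pairs `e₁` and `e₂` with a third vector, so `f₀ = 0` would make their cross product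
  -- vanish.
  have hf0 : f 0 ≠ 0 := by
    intro hf0
    obtain ⟨r, hr⟩ := key ![1, 0, 0, 0, 0, 0, 0] ![0, 1, 0, 0, 0, 0, 0]
      (fun h => by simpa using congrFun h 0) fun z => by
        simp [phiInv, wedge3_apply, hf0]
    simpa using congrFun hr 1
  set s := Real.sqrt (f 2 * f 3 - f 4 ^ 2) with hs
  have hspos : 0 < s := Real.sqrt_pos.2 (by linarith)
  have hs2 : s ^ 2 = f 2 * f 3 - f 4 ^ 2 := Real.sq_sqrt (by linarith)
  -- The vectors are `s e₁ + f₀ e₅` and `f₀(f₂ e₄ - s e₆ - f₄ e₇)`. Every component of the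
  -- contraction cancels identically except the one along `e³`, which is `f₀²(s² - f₂f₃ + f₄²)`;
  -- this dictates `s`. The vectors are independent, a contradiction.
  obtain ⟨r, hr⟩ := key ![s, 0, 0, 0, f 0, 0, 0]
    ![0, 0, 0, f 0 * f 2, 0, -(s * f 0), -(f 0 * f 4)]
    (fun h => hspos.ne' (by simpa using congrFun h 0)) fun z => by
      simp only [phiInv, wedge3_apply, Matrix.cons_val]
      linear_combination (f 0 ^ 2 * z 2) * hs2
  have := congrFun hr 5
  simp [hf0, hspos.ne'] at this

/-- The form `a θ¹²³ + b (θ¹ ∧ ω₁ + θ² ∧ ω₂ + θ³ ∧ ω₃)`, where `ω₁ = y⁰¹ - y²³`,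
`ω₂ = y⁰² + y¹³`, `ω₃ = y⁰³ - y¹²` and `y⁰, …, y³, θ¹, θ², θ³` are the coordinates. -/
def hyperkaehlerForm (a b : ℝ) (c : Fin 3 → Fin 7 → ℝ) : ℝ :=
  a * wedge3 4 5 6 c + b * (wedge3 4 0 1 c - wedge3 4 2 3 c + wedge3 5 0 2 c + wedge3 5 1 3 c
    + wedge3 6 0 3 c - wedge3 6 1 2 c)

theorem exists_cube_eq {a : ℝ} (ha : a ≠ 0) : ∃ r : ℝ, r ^ 3 = a ∧ 0 < a * r := by
  rcases lt_or_gt_of_ne ha with h | h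
  · have h3 : ((-a) ^ (1 / 3 : ℝ)) ^ 3 = -a := by
      rw [← Real.rpow_natCast, ← Real.rpow_mul (by linarith)]
      norm_num
    have hp : 0 < (-a) ^ (1 / 3 : ℝ) := Real.rpow_pos_of_pos (by linarith) _
    exact ⟨-(-a) ^ (1 / 3 : ℝ), by rw [Odd.neg_pow (by decide), h3]; ring, by nlinarith⟩
  · have h3 : (a ^ (1 / 3 : ℝ)) ^ 3 = a := by
      rw [← Real.rpow_natCast, ← Real.rpow_mul h.le]
      norm_num
    exact ⟨a ^ (1 / 3 : ℝ), h3, mul_pos h (Real.rpow_pos_of_pos h _)⟩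

/-- Scaling the `θ`'s by `r` and the `y`'s by `s` normalizes the form if `r³ = a` and `r s² = b`.
The second equation is solvable because `r` has the sign of `a`, hence of `b`. -/
theorem isPositive_of_hyperkaehlerForm (e : Module.Basis (Fin 7) ℝ V) {a b : ℝ} (hab : 0 < a * b)
    (h : ∀ w, φ w = hyperkaehlerForm a b fun k i => e.repr (w k) i) : IsPositive φ := by
  have ha : a ≠ 0 := left_ne_zero_of_mul hab.ne'
  obtain ⟨r, hr, har⟩ := exists_cube_eq ha
  have hr0 : r ≠ 0 := right_ne_zero_of_mul har.ne'
  have hbr : 0 < b / r := by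
    have h1 : 0 < (a * b) * (a * r) := mul_pos hab har
    have h2 : 0 < (b * r) * a ^ 2 := by nlinarith
    have h3 : 0 < b * r := pos_of_mul_pos_left h2 (sq_nonneg a)
    have h4 : b / r = b * r / r ^ 2 := by field_simp
    rw [h4]
    positivity
  set s := Real.sqrt (b / r) with hs
  have hs2 : r * s ^ 2 = b := by
    rw [hs, Real.sq_sqrt hbr.le]; field_simp
  have hs0 : s ≠ 0 := (Real.sqrt_pos.2 hbr).ne'
  -- The adapted coframe is `rθ¹, rθ³, -rθ², sy⁰, sy¹, sy³, sy²`.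
  let σ : Equiv.Perm (Fin 7) :=
    { toFun := ![3, 4, 6, 5, 0, 2, 1]
      invFun := ![4, 6, 5, 0, 1, 3, 2]
      left_inv := by decide
      right_inv := by decide }
  let m : Fin 7 → ℝ := ![r, r, -r, s, s, s, s]
  have hm : ∀ i, IsUnit (m i)⁻¹ := fun i => by
    rw [isUnit_iff_ne_zero]
    fin_cases i <;> simp [m, hr0, hs0]
  let u := (e.reindex σ).isUnitSMul hm
  have hrepr : ∀ x i, u.repr x i = m i * e.repr x (σ.symm i) := by
    intro x i
    rw [Module.Basis.repr_isUnitSMul, Units.smul_def, Units.val_inv_eq_inv_val, IsUnit.unit_spec,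
      inv_inv, Module.Basis.repr_reindex_apply, smul_eq_mul]
  refine ⟨u, fun w => ?_⟩
  rw [h]
  simp only [hrepr]
  simp only [phiStd_apply, hyperkaehlerForm, wedge3_apply]
  simp [m, σ, Equiv.symm]
  rw [← hr, ← hs2]
  ring

end Nondegenerate

end NPExtension

namespace NPExtension

/-! ### The differential of the action -/

section Action

theorem contMDiff_mul_mul (a b : Sp1) :
    ContMDiff (𝓡 3) (𝓡 3) ∞ (fun x : Sp1 => a * x * b) := by
  have h : ContMDiff (𝓡 3) 𝓘(ℝ, ℍ[ℝ]) ∞ (fun x : Sp1 => (a : ℍ[ℝ]) * (x : ℍ[ℝ]) * (b : ℍ[ℝ])) := by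
    have h1 : ContDiff ℝ ∞ (fun x : ℍ[ℝ] => (a : ℍ[ℝ]) * x * (b : ℍ[ℝ])) := by fun_prop
    exact h1.contMDiff.comp contMDiff_coe_sphere
  exact h.codRestrict_sphere fun x => (a * x * b).2

theorem contMDiff_act (g : G) : ContMDiff IM IM ∞ (act g) := by
  have h1 : ContDiff ℝ ∞ (fun y : ℍ[ℝ] => (g.2.1 : ℍ[ℝ]) * y * ((g.2.2⁻¹ : Sp1) : ℍ[ℝ])) := by
    fun_prop
  exact ((contMDiff_mul_mul g.1 g.2.2⁻¹).comp contMDiff_fst).prodMk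
    (h1.contMDiff.comp contMDiff_snd)

/-- The differential of the inclusion `Sp(1) ⊆ ℍ`. -/
noncomputable def dcoe (x : Sp1) : EuclideanSpace ℝ (Fin 3) →L[ℝ] ℍ[ℝ] :=
  mfderiv (𝓡 3) 𝓘(ℝ, ℍ[ℝ]) (fun x : Sp1 => (x : ℍ[ℝ])) x

theorem hasMFDerivAt_coe (x : Sp1) :
    HasMFDerivAt (𝓡 3) 𝓘(ℝ, ℍ[ℝ]) (fun x : Sp1 => (x : ℍ[ℝ])) x (dcoe x) :=
  ((contMDiff_coe_sphere (m := 1)).mdifferentiable (by simp) x).hasMFDerivAt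

theorem dcoe_injective (x : Sp1) : Function.Injective (dcoe x) := by
  convert! injective_mvfderiv_subtypeVal_sphere (E := ℍ[ℝ]) (n := 3) x

/-- The differential of the action. -/
noncomputable def dact (g : G) (p : M) : E →L[ℝ] E := mfderiv IM IM (act g) p

theorem hasMFDerivAt_act (g : G) (p : M) : HasMFDerivAt IM IM (act g) p (dact g p) :=
  ((contMDiff_act g).mdifferentiable (by simp) p).hasMFDerivAt

/-- Seen in the ambient `ℍ`, the action is the restriction of a linear map, which is its own
derivative; no chart of the sphere enters. -/
theorem dcoe_dact_fst (g : G) (p : M) (v : E) :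
    dcoe (act g p).1 (dact g p v).1 =
      (g.1 : ℍ[ℝ]) * dcoe p.1 v.1 * ((g.2.2⁻¹ : Sp1) : ℍ[ℝ]) := by
  let A : ℍ[ℝ] →L[ℝ] ℍ[ℝ] :=
    (ContinuousLinearMap.mul ℝ ℍ[ℝ] (g.1 : ℍ[ℝ])).comp
      ((ContinuousLinearMap.mul ℝ ℍ[ℝ]).flip ((g.2.2⁻¹ : Sp1) : ℍ[ℝ]))
  have hA : ∀ z, A z = (g.1 : ℍ[ℝ]) * z * ((g.2.2⁻¹ : Sp1) : ℍ[ℝ]) := fun z => by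
    simp [A, mul_assoc]
  have h1 : HasMFDerivAt IM 𝓘(ℝ, ℍ[ℝ]) (fun p : M => (((act g p).1 : Sp1) : ℍ[ℝ])) p
      ((dcoe (act g p).1).comp ((ContinuousLinearMap.fst ℝ _ _).comp (dact g p))) :=
    (hasMFDerivAt_coe (act g p).1).comp p
      ((hasMFDerivAt_fst (act g p)).comp p (hasMFDerivAt_act g p))
  have h2 : HasMFDerivAt IM 𝓘(ℝ, ℍ[ℝ]) (fun p : M => A (p.1 : ℍ[ℝ])) p
      (A.comp ((dcoe p.1).comp (ContinuousLinearMap.fst ℝ _ _))) :=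
    (A.hasFDerivAt.hasMFDerivAt).comp p ((hasMFDerivAt_coe p.1).comp p (hasMFDerivAt_fst p))
  have h3 : (fun p : M => A (p.1 : ℍ[ℝ])) = fun p : M => (((act g p).1 : Sp1) : ℍ[ℝ]) :=
    funext fun p => hA _
  rw [h3] at h2
  have h4 := hasMFDerivAt_unique h1 h2
  have h5 := congrArg (fun L : E →L[ℝ] ℍ[ℝ] => L v) h4
  exact h5.trans (hA _)

theorem dact_snd (g : G) (p : M) (v : E) :
    (dact g p v).2 = (g.2.1 : ℍ[ℝ]) * v.2 * ((g.2.2⁻¹ : Sp1) : ℍ[ℝ]) := by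
  let A : ℍ[ℝ] →L[ℝ] ℍ[ℝ] :=
    (ContinuousLinearMap.mul ℝ ℍ[ℝ] (g.2.1 : ℍ[ℝ])).comp
      ((ContinuousLinearMap.mul ℝ ℍ[ℝ]).flip ((g.2.2⁻¹ : Sp1) : ℍ[ℝ]))
  have hA : ∀ z, A z = (g.2.1 : ℍ[ℝ]) * z * ((g.2.2⁻¹ : Sp1) : ℍ[ℝ]) := fun z => by
    simp [A, mul_assoc]
  have h1 : HasMFDerivAt IM 𝓘(ℝ, ℍ[ℝ]) (fun p : M => (act g p).2) p
      ((ContinuousLinearMap.snd ℝ _ _).comp (dact g p)) :=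
    (hasMFDerivAt_snd (act g p)).comp p (hasMFDerivAt_act g p)
  have h2 : HasMFDerivAt IM 𝓘(ℝ, ℍ[ℝ]) (fun p : M => A p.2) p
      (A.comp (ContinuousLinearMap.snd ℝ _ _)) :=
    (A.hasFDerivAt.hasMFDerivAt).comp p (hasMFDerivAt_snd p)
  have h3 : (fun p : M => A p.2) = fun p : M => (act g p).2 :=
    funext fun p => hA _
  rw [h3] at h2
  have h4 := hasMFDerivAt_unique h1 h2
  have h5 := congrArg (fun L : E →L[ℝ] ℍ[ℝ] => L v) h4
  exact h5.trans (hA _)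

theorem act_mul (g h : G) (p : M) : act (g * h) p = act g (act h p) := by
  refine Prod.ext ?_ ?_
  · simp only [act, Prod.fst_mul, Prod.snd_mul, mul_inv_rev]
    group
  · simp only [act, Prod.fst_mul, Prod.snd_mul, mul_inv_rev]
    change ((g.2.1 : ℍ[ℝ]) * (h.2.1 : ℍ[ℝ])) * p.2 *
      (((h.2.2⁻¹ : Sp1) : ℍ[ℝ]) * ((g.2.2⁻¹ : Sp1) : ℍ[ℝ])) = _
    simp only [mul_assoc]

theorem act_one (p : M) : act 1 p = p := by
  refine Prod.ext ?_ ?_ <;> simp [act]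

/-- Tangent vectors with equal components in `ℍ × ℍ` are equal. -/
theorem tangent_ext (x : Sp1) {v w : E} (h1 : dcoe x v.1 = dcoe x w.1) (h2 : v.2 = w.2) :
    v = w :=
  Prod.ext (dcoe_injective x h1) h2

theorem dact_mul (g h : G) (p : M) (v : E) :
    dact (g * h) p v = dact g (act h p) (dact h p v) := by
  have h1 : HasMFDerivAt IM IM (act (g * h)) p ((dact g (act h p)).comp (dact h p)) := by
    have := (hasMFDerivAt_act g (act h p)).comp p (hasMFDerivAt_act h p)
    have e : act g ∘ act h = act (g * h) := funext fun p => (act_mul g h p).symm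
    rwa [e] at this
  exact congrArg (fun L : E →L[ℝ] E => L v) (hasMFDerivAt_unique (hasMFDerivAt_act (g * h) p) h1)

theorem dact_one (p : M) (v : E) : dact 1 p v = v := by
  have h1 : HasMFDerivAt IM IM (act 1) p (ContinuousLinearMap.id ℝ E) := by
    have e : act 1 = id := funext act_one
    rw [e]
    exact hasMFDerivAt_id p
  exact congrArg (fun L : E →L[ℝ] E => L v) (hasMFDerivAt_unique (hasMFDerivAt_act 1 p) h1)

end Action

end NPExtension

namespace NPExtension

/-! ### Induced vector fields and the frame along `γ` -/

section Frame

theorem coe_inv_eq_star (q : Sp1) : ((q⁻¹ : Sp1) : ℍ[ℝ]) = star (q : ℍ[ℝ]) := by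
  have h1 : (q : ℍ[ℝ]) * star (q : ℍ[ℝ]) = 1 := by
    have hq : ‖(q : ℍ[ℝ])‖ = 1 := by simp
    rw [Quaternion.self_mul_star, Quaternion.normSq_eq_norm_mul_self, hq]
    simp
  have h2 : ((q⁻¹ : Sp1) : ℍ[ℝ]) * (q : ℍ[ℝ]) = 1 := congrArg Subtype.val (inv_mul_cancel q)
  calc ((q⁻¹ : Sp1) : ℍ[ℝ]) = ((q⁻¹ : Sp1) : ℍ[ℝ]) * ((q : ℍ[ℝ]) * star (q : ℍ[ℝ])) := by
        rw [h1, mul_one]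
    _ = star (q : ℍ[ℝ]) := by rw [← mul_assoc, h2, one_mul]

/-- Quaternionic conjugation as a continuous linear map. -/
noncomputable def conjL : ℍ[ℝ] →L[ℝ] ℍ[ℝ] :=
  LinearMap.toContinuousLinearMap
    { toFun := star
      map_add' := star_add
      map_smul' := fun r z => by ext <;> simp }

theorem contDiff_star_quaternion {n : ℕ∞ω} : ContDiff ℝ n (star : ℍ[ℝ] → ℍ[ℝ]) :=
  conjL.contDiff

theorem sp1Basis_re (a : Fin 3) : (sp1Basis a).re = 0 := by fin_cases a <;> rfl

theorem sp1Basis_imI (a : Fin 3) : (sp1Basis a).imI = ![1, 0, 0] a := by fin_cases a <;> rfl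

theorem sp1Basis_imJ (a : Fin 3) : (sp1Basis a).imJ = ![0, 1, 0] a := by fin_cases a <;> rfl

theorem sp1Basis_imK (a : Fin 3) : (sp1Basis a).imK = ![0, 0, 1] a := by fin_cases a <;> rfl

theorem hasDerivAt_expSp (X : ℍ[ℝ]) (s : ℝ) :
    HasDerivAt (fun s : ℝ => (expSp (s • X) : ℍ[ℝ])) (expSp (s • X) * X.im) s := by
  have := hasDerivAt_exp_smul_const (𝕂 := ℝ) X.im s
  simpa [expSp] using this

theorem contDiff_expSp (X : ℍ[ℝ]) : ContDiff ℝ 1 (fun s : ℝ => (expSp (s • X) : ℍ[ℝ])) := by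
  rw [contDiff_one_iff_deriv]
  refine ⟨fun s => (hasDerivAt_expSp X s).differentiableAt, ?_⟩
  have h : deriv (fun s : ℝ => (expSp (s • X) : ℍ[ℝ])) =
      fun s => (expSp (s • X) : ℍ[ℝ]) * X.im := funext fun s => (hasDerivAt_expSp X s).deriv
  rw [h]
  have hd : Differentiable ℝ (fun s : ℝ => (expSp (s • X) : ℍ[ℝ])) :=
    fun s => (hasDerivAt_expSp X s).differentiableAt
  exact hd.continuous.mul continuous_const

theorem contMDiff_sphere_curve {c : ℝ → Sp1} (hc : ContDiff ℝ 1 (fun s => (c s : ℍ[ℝ]))) :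
    ContMDiff 𝓘(ℝ, ℝ) (𝓡 3) 1 c :=
  hc.contMDiff.codRestrict_sphere fun s => (c s).2

theorem expSp_zero_smul (X : ℍ[ℝ]) : expSp ((0 : ℝ) • X) = 1 := by
  apply Subtype.ext
  simp [expSp]

/-- The curve `s ↦ exp(sX) · p`. -/
noncomputable def orbitCurve (X : ℍ[ℝ] × ℍ[ℝ] × ℍ[ℝ]) (p : M) (s : ℝ) : M :=
  act (expSp (s • X.1), expSp (s • X.2.1), expSp (s • X.2.2)) p

theorem orbitCurve_zero (X : ℍ[ℝ] × ℍ[ℝ] × ℍ[ℝ]) (p : M) : orbitCurve X p 0 = p := by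
  simp only [orbitCurve, expSp_zero_smul]
  exact act_one p

theorem hasDerivAt_orbit (X Z y : ℍ[ℝ]) :
    HasDerivAt (fun s : ℝ => (expSp (s • X) : ℍ[ℝ]) * y *
      (((expSp (s • Z))⁻¹ : Sp1) : ℍ[ℝ])) (X.im * y - y * Z.im) 0 := by
  have h1 : HasDerivAt (fun s : ℝ => (expSp (s • X) : ℍ[ℝ])) X.im 0 := by
    have h := hasDerivAt_expSp X 0
    rw [expSp_zero_smul] at h
    simpa using h
  have h2 : HasDerivAt (fun s : ℝ => (expSp (s • Z) : ℍ[ℝ])) Z.im 0 := by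
    have h := hasDerivAt_expSp Z 0
    rw [expSp_zero_smul] at h
    simpa using h
  have h3 : HasDerivAt (fun s : ℝ => (((expSp (s • Z))⁻¹ : Sp1) : ℍ[ℝ])) (star Z.im) 0 := by
    simp only [coe_inv_eq_star]
    exact conjL.hasFDerivAt.comp_hasDerivAt 0 h2
  have h4 := (h1.mul_const y).mul h3
  simp only [expSp_zero_smul] at h4
  convert! h4 using 1
  simp [sub_eq_add_neg]

theorem contDiff_orbit (X Z y : ℍ[ℝ]) :
    ContDiff ℝ 1 (fun s : ℝ => (expSp (s • X) : ℍ[ℝ]) * y *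
      (((expSp (s • Z))⁻¹ : Sp1) : ℍ[ℝ])) := by
  simp only [coe_inv_eq_star]
  exact ((contDiff_expSp X).mul contDiff_const).mul
    (contDiff_star_quaternion.comp (contDiff_expSp Z))

theorem hasMFDerivAt_orbitCurve (X : ℍ[ℝ] × ℍ[ℝ] × ℍ[ℝ]) (p : M) :
    HasMFDerivAt 𝓘(ℝ, ℝ) IM (orbitCurve X p) 0 (mfderiv 𝓘(ℝ, ℝ) IM (orbitCurve X p) 0) := by
  have h1 : ContMDiff 𝓘(ℝ, ℝ) (𝓡 3) 1 (fun s => (orbitCurve X p s).1) :=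
    contMDiff_sphere_curve (contDiff_orbit X.1 X.2.2 p.1)
  have h2 : ContMDiff 𝓘(ℝ, ℝ) 𝓘(ℝ, ℍ[ℝ]) 1 (fun s => (orbitCurve X p s).2) :=
    (contDiff_orbit X.2.1 X.2.2 p.2).contMDiff
  exact ((h1.prodMk h2).mdifferentiable (by simp) 0).hasMFDerivAt

theorem dcoe_killing_fst (X : ℍ[ℝ] × ℍ[ℝ] × ℍ[ℝ]) (p : M) :
    dcoe p.1 (killing X p : E).1 = X.1.im * (p.1 : ℍ[ℝ]) - (p.1 : ℍ[ℝ]) * X.2.2.im := by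
  have h1 : HasMFDerivAt 𝓘(ℝ, ℝ) 𝓘(ℝ, ℍ[ℝ]) (fun s : ℝ => ((orbitCurve X p s).1 : ℍ[ℝ])) 0
      ((dcoe (orbitCurve X p 0).1).comp ((ContinuousLinearMap.fst ℝ _ _).comp
        (mfderiv 𝓘(ℝ, ℝ) IM (orbitCurve X p) 0 : ℝ →L[ℝ] E))) :=
    (hasMFDerivAt_coe (orbitCurve X p 0).1).comp 0
      ((hasMFDerivAt_fst (orbitCurve X p 0)).comp 0 (hasMFDerivAt_orbitCurve X p))
  have h2 : HasMFDerivAt 𝓘(ℝ, ℝ) 𝓘(ℝ, ℍ[ℝ]) (fun s : ℝ => ((orbitCurve X p s).1 : ℍ[ℝ])) 0 _ :=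
    (hasDerivAt_orbit X.1 X.2.2 p.1).hasFDerivAt.hasMFDerivAt
  have h3 := congrArg (fun L : ℝ →L[ℝ] ℍ[ℝ] => L 1) (hasMFDerivAt_unique h1 h2)
  have h4 : dcoe (orbitCurve X p 0).1 (killing X p : E).1 =
      X.1.im * (p.1 : ℍ[ℝ]) - (p.1 : ℍ[ℝ]) * X.2.2.im := by
    refine Eq.trans h3 ?_
    simp
  rwa [orbitCurve_zero] at h4

theorem killing_snd (X : ℍ[ℝ] × ℍ[ℝ] × ℍ[ℝ]) (p : M) :
    (killing X p : E).2 = X.2.1.im * p.2 - p.2 * X.2.2.im := by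
  have h1 : HasMFDerivAt 𝓘(ℝ, ℝ) 𝓘(ℝ, ℍ[ℝ]) (fun s : ℝ => (orbitCurve X p s).2) 0
      ((ContinuousLinearMap.snd ℝ _ _).comp
        (mfderiv 𝓘(ℝ, ℝ) IM (orbitCurve X p) 0 : ℝ →L[ℝ] E)) :=
    (hasMFDerivAt_snd (orbitCurve X p 0)).comp 0 (hasMFDerivAt_orbitCurve X p)
  have h2 : HasMFDerivAt 𝓘(ℝ, ℝ) 𝓘(ℝ, ℍ[ℝ]) (fun s : ℝ => (orbitCurve X p s).2) 0 _ :=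
    (hasDerivAt_orbit X.2.1 X.2.2 p.2).hasFDerivAt.hasMFDerivAt
  have h3 := congrArg (fun L : ℝ →L[ℝ] ℍ[ℝ] => L 1) (hasMFDerivAt_unique h1 h2)
  refine Eq.trans h3 ?_
  simp

theorem mem_range_dcoe_one (z : ℍ[ℝ]) : (∃ w, dcoe 1 w = z) ↔ z.re = 0 := by
  have h := range_mvfderiv_subtypeVal (E := ℍ[ℝ]) (n := 3) (1 : Sp1)
  have h1 : (∃ w, dcoe 1 w = z) ↔ z ∈ (ℝ ∙ ((1 : Sp1) : ℍ[ℝ]))ᗮ := by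
    rw [← h]; rfl
  rw [h1, Submodule.mem_orthogonal_singleton_iff_inner_right, Quaternion.inner_def]
  simp

theorem re_dcoe_one (w : EuclideanSpace ℝ (Fin 3)) : (dcoe 1 w).re = 0 :=
  (mem_range_dcoe_one _).1 ⟨w, rfl⟩

/-- The tangent vectors `i, j, k` of `Sp(1)` at `1`. -/
noncomputable def imVec (a : Fin 3) : EuclideanSpace ℝ (Fin 3) :=
  ((mem_range_dcoe_one (sp1Basis a)).2 (by fin_cases a <;> rfl)).choose

theorem dcoe_imVec (a : Fin 3) : dcoe 1 (imVec a) = sp1Basis a :=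
  ((mem_range_dcoe_one (sp1Basis a)).2 (by fin_cases a <;> rfl)).choose_spec

/-- The coordinates of a tangent vector of `Sp(1)` at `1`. -/
noncomputable def imCoord (w : EuclideanSpace ℝ (Fin 3)) : Fin 3 → ℝ :=
  ![(dcoe 1 w).imI, (dcoe 1 w).imJ, (dcoe 1 w).imK]

theorem sum_imCoord (w : EuclideanSpace ℝ (Fin 3)) : ∑ a, imCoord w a • imVec a = w := by
  apply dcoe_injective 1
  rw [map_sum]
  simp only [map_smul, dcoe_imVec]
  ext <;> simp [Fin.sum_univ_three, imCoord, re_dcoe_one, sp1Basis_re, sp1Basis_imI,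
    sp1Basis_imJ, sp1Basis_imK]

/-- The frame along `γ` in the coordinates of `E`. -/
theorem frame_eq (t : ℝ) : (frame t : Fin 7 → E) =
    ![(0, 1), (0, (-3 * t) • sp1Basis 0), (0, (-3 * t) • sp1Basis 1), (0, (-3 * t) • sp1Basis 2),
      ((-3 : ℝ) • imVec 0, 0), ((-3 : ℝ) • imVec 1, 0), ((-3 : ℝ) • imVec 2, 0)] := by
  have h0 : (frame t 0 : E) = (0, 1) := by
    have h1 : HasMFDerivAt 𝓘(ℝ, ℝ) IM gamma t
        ((0 : ℝ →L[ℝ] EuclideanSpace ℝ (Fin 3)).prod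
          ((1 : ℝ →L[ℝ] ℝ).smulRight (1 : ℍ[ℝ]))) := by
      refine (hasMFDerivAt_const (1 : Sp1) t).prodMk ?_
      have h2 : HasDerivAt (fun t : ℝ => (t : ℍ[ℝ])) 1 t := by
        have h3 := (hasDerivAt_id t).smul_const (1 : ℍ[ℝ])
        have e : (fun t : ℝ => (t : ℍ[ℝ])) = fun t : ℝ => t • (1 : ℍ[ℝ]) := by
          funext t
          ext <;> simp
        rw [e]
        simpa using h3
      exact h2.hasFDerivAt.hasMFDerivAt
    have h2 := congrArg (fun L : ℝ →L[ℝ] E => L 1) h1.mfderiv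
    refine Eq.trans h2 (Prod.ext rfl ?_)
    exact one_smul ℝ (1 : ℍ[ℝ])
  -- At `(1, t)` the triple `(X, -2X, X)` gives `X - X = 0` on the sphere and `-2Xt - tX = -3tX` on
  -- the fibre.
  have hp : ∀ a, (killing (jPlus (sp1Basis a)) (gamma t) : E) = (0, (-3 * t) • sp1Basis a) := by
    intro a
    refine tangent_ext 1 ?_ ?_
    · refine (dcoe_killing_fst (jPlus (sp1Basis a)) (gamma t)).trans ?_
      simp [jPlus, gamma]
    · refine (killing_snd (jPlus (sp1Basis a)) (gamma t)).trans ?_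
      ext <;> simp [jPlus, gamma, sp1Basis_re, sp1Basis_imI, sp1Basis_imJ, sp1Basis_imK] <;> ring
  -- Here `-2X - X = -3X` on the sphere and `Xt - tX = 0` on the fibre, since `t` is real.
  have hm : ∀ a, (killing (jMinus (sp1Basis a)) (gamma t) : E) = ((-3 : ℝ) • imVec a, 0) := by
    intro a
    refine tangent_ext 1 ?_ ?_
    · refine (dcoe_killing_fst (jMinus (sp1Basis a)) (gamma t)).trans ?_
      rw [map_smul, dcoe_imVec]
      ext <;> simp [jMinus, gamma, sp1Basis_re, sp1Basis_imI, sp1Basis_imJ, sp1Basis_imK] <;> ring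
    · refine (killing_snd (jMinus (sp1Basis a)) (gamma t)).trans ?_
      ext <;> simp [jMinus, gamma, sp1Basis_imI, sp1Basis_imJ, sp1Basis_imK, mul_comm]
  funext i
  fin_cases i
  · exact h0
  · exact hp 0
  · exact hp 1
  · exact hp 2
  · exact hm 0
  · exact hm 1
  · exact hm 2

end Frame

end NPExtension

namespace NPExtension

/-! ### Charts and trivialized forms -/

section Charts

theorem isOpen_chartSet (x : M) {U : Set M} (hU : IsOpen U) : IsOpen (chartSet x U) :=
  (continuousOn_extChartAt_symm x).isOpen_inter_preimage (isOpen_extChartAt_target x) hU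

theorem isOpen_tube (T : EReal) : IsOpen (tube T) :=
  isOpen_lt (continuous_coe_real_ereal.comp (continuous_norm.comp continuous_snd)) continuous_const

theorem isOpen_regularTube (T : EReal) : IsOpen (regularTube T) :=
  (isOpen_tube T).inter (isOpen_compl_singleton.preimage continuous_snd)

/-- The differential of the inverse of a chart. -/
noncomputable def dchart (x : M) (z : E) : E →L[ℝ] E :=
  mfderiv 𝓘(ℝ, E) IM (extChartAt IM x).symm z

theorem contMDiffAt_chart_symm (x : M) {z : E} (hz : z ∈ (extChartAt IM x).target) :
    ContMDiffAt 𝓘(ℝ, E) IM ∞ (extChartAt IM x).symm z :=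
  (contMDiffOn_extChartAt_symm x).contMDiffAt ((isOpen_extChartAt_target x).mem_nhds hz)

theorem hasMFDerivAt_chart_symm (x : M) {z : E} (hz : z ∈ (extChartAt IM x).target) :
    HasMFDerivAt 𝓘(ℝ, E) IM (extChartAt IM x).symm z (dchart x z) :=
  ((contMDiffAt_chart_symm x hz).mdifferentiableAt (by simp)).hasMFDerivAt

theorem chart_symm_snd (x : M) (z : E) : ((extChartAt IM x).symm z).2 = z.2 := rfl

theorem dchart_snd (x : M) {z : E} (hz : z ∈ (extChartAt IM x).target) (v : E) :
    (dchart x z v).2 = v.2 := by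
  have h1 : HasMFDerivAt 𝓘(ℝ, E) 𝓘(ℝ, ℍ[ℝ]) (fun z : E => z.2) z
      ((ContinuousLinearMap.snd ℝ (EuclideanSpace ℝ (Fin 3)) ℍ[ℝ]).comp (dchart x z)) :=
    (hasMFDerivAt_snd ((extChartAt IM x).symm z)).comp z (hasMFDerivAt_chart_symm x hz)
  have h2 : HasMFDerivAt 𝓘(ℝ, E) 𝓘(ℝ, ℍ[ℝ]) (fun z : E => z.2) z
      (ContinuousLinearMap.snd ℝ (EuclideanSpace ℝ (Fin 3)) ℍ[ℝ]) :=
    (ContinuousLinearMap.snd ℝ (EuclideanSpace ℝ (Fin 3)) ℍ[ℝ]).hasFDerivAt.hasMFDerivAt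
  exact congrArg (fun L : E →L[ℝ] ℍ[ℝ] => L v) (hasMFDerivAt_unique h1 h2)

/-- The `Sp(1)`-component of the inverse of a chart, as a map into `ℍ`. -/
noncomputable def chartCoe (x : M) (z : E) : ℍ[ℝ] := (((extChartAt IM x).symm z).1 : ℍ[ℝ])

theorem contDiffOn_chartCoe (x : M) : ContDiffOn ℝ ∞ (chartCoe x) (extChartAt IM x).target := by
  intro z hz
  have h : ContMDiffAt 𝓘(ℝ, E) 𝓘(ℝ, ℍ[ℝ]) ∞ (chartCoe x) z :=
    (contMDiff_coe_sphere.contMDiffAt.comp _ contMDiffAt_fst).comp z (contMDiffAt_chart_symm x hz)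
  exact h.contDiffAt.contDiffWithinAt

theorem dcoe_dchart_fst (x : M) {z : E} (hz : z ∈ (extChartAt IM x).target) (v : E) :
    dcoe ((extChartAt IM x).symm z).1 (dchart x z v).1 = fderiv ℝ (chartCoe x) z v := by
  have h1 : HasMFDerivAt 𝓘(ℝ, E) 𝓘(ℝ, ℍ[ℝ]) (chartCoe x) z
      ((dcoe ((extChartAt IM x).symm z).1).comp
        ((ContinuousLinearMap.fst ℝ (EuclideanSpace ℝ (Fin 3)) ℍ[ℝ]).comp (dchart x z))) :=
    (hasMFDerivAt_coe _).comp z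
      ((hasMFDerivAt_fst ((extChartAt IM x).symm z)).comp z (hasMFDerivAt_chart_symm x hz))
  have h2 : HasFDerivAt (chartCoe x) ((dcoe ((extChartAt IM x).symm z).1).comp
      ((ContinuousLinearMap.fst ℝ (EuclideanSpace ℝ (Fin 3)) ℍ[ℝ]).comp (dchart x z))) z :=
    h1.hasFDerivAt
  exact (congrArg (fun L : E →L[ℝ] ℍ[ℝ] => L v) h2.fderiv).symm

theorem localForm_apply (x : M) (φ : ThreeForm) (z : E) (v : Fin 3 → E) :
    localForm x φ z v = (φ ((extChartAt IM x).symm z) : E [⋀^Fin 3]→L[ℝ] ℝ)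
      fun i => dchart x z (v i) := rfl

/-- The point of the chart around `(1, 0)` corresponding to `(1, y)`. -/
noncomputable def fiberPoint (y : ℍ[ℝ]) : E := ((extChartAt IM ((1, 0) : M) (1, 0)).1, y)

theorem extChartAt_one (y : ℍ[ℝ]) :
    extChartAt IM ((1, y) : M) = extChartAt IM ((1, 0) : M) := rfl

theorem fiberPoint_eq (y : ℍ[ℝ]) : extChartAt IM ((1, y) : M) (1, y) = fiberPoint y := rfl

theorem fiberPoint_mem (y : ℍ[ℝ]) : fiberPoint y ∈ (extChartAt IM ((1, 0) : M)).target := by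
  rw [← fiberPoint_eq, ← extChartAt_one y]
  exact mem_extChartAt_target (I := IM) ((1, y) : M)

theorem chart_symm_fiberPoint (y : ℍ[ℝ]) :
    (extChartAt IM ((1, 0) : M)).symm (fiberPoint y) = (1, y) := by
  rw [← fiberPoint_eq, ← extChartAt_one y]
  exact extChartAt_to_inv (I := IM) ((1, y) : M)

/-- One chart serves all points `(1, y)`, and each is a base point of it, where the inverse chart
has identity differential. Hence the local form there is literally the form on `E`. -/
theorem dchart_fiberPoint (y : ℍ[ℝ]) (v : E) : dchart (1, 0) (fiberPoint y) v = v := by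
  have h := mfderivWithin_range_extChartAt_symm (I := IM) (x := ((1, y) : M))
  have hr : Set.range IM = Set.univ := IM.range_eq_univ
  rw [hr, mfderivWithin_univ] at h
  exact congrArg (fun L : E →L[ℝ] E => L v) h

/-- The restriction of a form to the fibre `{1} × ℍ`. -/
noncomputable def fiberForm (φ : ThreeForm) (y : ℍ[ℝ]) : E [⋀^Fin 3]→L[ℝ] ℝ := φ ((1, y) : M)

theorem localForm_fiberPoint (φ : ThreeForm) (y : ℍ[ℝ]) :
    localForm (1, 0) φ (fiberPoint y) = fiberForm φ y := by
  ext v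
  rw [localForm_apply]
  simp only [dchart_fiberPoint]
  have h : ∀ p : M, p = (1, y) → (φ p : E [⋀^Fin 3]→L[ℝ] ℝ) = fiberForm φ y := by
    rintro _ rfl; rfl
  exact congrArg (fun A : E [⋀^Fin 3]→L[ℝ] ℝ => A v) (h _ (chart_symm_fiberPoint y))

theorem SmoothOn.contDiffOn_fiberForm {U : Set M} {φ : ThreeForm} (h : SmoothOn U φ) :
    ContDiffOn ℝ ∞ (fiberForm φ) {y | ((1, y) : M) ∈ U} := by
  have h1 : fiberForm φ = fun y => localForm (1, 0) φ (fiberPoint y) :=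
    funext fun y => (localForm_fiberPoint φ y).symm
  rw [h1]
  refine (h (1, 0)).comp (ContDiff.contDiffOn (contDiff_const.prodMk contDiff_id)) fun y hy => ?_
  refine ⟨fiberPoint_mem y, ?_⟩
  change (extChartAt IM ((1, 0) : M)).symm (fiberPoint y) ∈ U
  rw [chart_symm_fiberPoint]
  exact hy

/-- The element of `G` moving `(x, y)` to `(1, y)`. -/
noncomputable def toFiber (p : M) : G := (p.1⁻¹, 1, 1)

theorem act_toFiber (p : M) : act (toFiber p) p = (1, p.2) := by
  refine Prod.ext ?_ ?_ <;> simp [act, toFiber]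

/-- The form which is left-invariant in the `Sp(1)`-direction and agrees with `Ψ` on `{1} × ℍ`. -/
noncomputable def ofFiberForm (Ψ : ℍ[ℝ] → E [⋀^Fin 3]→L[ℝ] ℝ) : ThreeForm := fun p =>
  (Ψ p.2).compContinuousLinearMap (dact (toFiber p) p)

theorem exists_leftInverse_dcoe_one :
    ∃ R : ℍ[ℝ] →L[ℝ] EuclideanSpace ℝ (Fin 3), ∀ w, R (dcoe 1 w) = w := by
  obtain ⟨R, hR⟩ := (dcoe 1).toLinearMap.exists_leftInverse_of_injective
    (LinearMap.ker_eq_bot.2 (dcoe_injective 1))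
  exact ⟨LinearMap.toContinuousLinearMap R, fun w => LinearMap.congr_fun hR w⟩

/-- In a chart, left translation to the fibre has `Sp(1)`-component `x̄ dx`, the Maurer-Cartan form,
which is smooth; `R` only converts imaginary quaternions back to model coordinates. -/
theorem smoothOn_ofFiberForm {U : Set M} {Ψ : ℍ[ℝ] → E [⋀^Fin 3]→L[ℝ] ℝ} {s : Set ℍ[ℝ]}
    (hΨ : ContDiffOn ℝ ∞ Ψ s) (hs : ∀ p ∈ U, p.2 ∈ s) : SmoothOn U (ofFiberForm Ψ) := by
  intro x
  obtain ⟨R, hR⟩ := exists_leftInverse_dcoe_one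
  let σ : E → M := (extChartAt IM x).symm
  let L : E → E →L[ℝ] E := fun z => (dact (toFiber (σ z)) (σ z)).comp (dchart x z)
  have h1 : localForm x (ofFiberForm Ψ) = fun z => (Ψ z.2).compContinuousLinearMap (L z) := rfl
  rw [h1]
  have htarget : chartSet x U ⊆ (extChartAt IM x).target := Set.inter_subset_left
  refine contDiffOn_alternating_comp (hΨ.comp contDiff_snd.contDiffOn fun z hz => hs _ hz.2)
    fun v => ?_
  have h2 : ∀ z ∈ chartSet x U, L z v =
      (R (star (chartCoe x z) * fderiv ℝ (chartCoe x) z v), v.2) := by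
    intro z hz
    have hz' := htarget hz
    refine Prod.ext ?_ ?_
    · have h3 := dcoe_dact_fst (toFiber (σ z)) (σ z) (dchart x z v)
      rw [act_toFiber] at h3
      rw [dcoe_dchart_fst x hz' v] at h3
      have h4 : R (dcoe 1 (L z v).1) = (L z v).1 := hR _
      rw [← h4]
      refine congrArg R (h3.trans ?_)
      simp only [toFiber, inv_one, coe_inv_eq_star]
      exact mul_one _
    · have h3 := dact_snd (toFiber (σ z)) (σ z) (dchart x z v)
      rw [dchart_snd x hz'] at h3
      refine h3.trans ?_
      simp [toFiber]
  refine ContDiffOn.congr ?_ h2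
  have h5 : ContDiffOn ℝ ∞ (chartCoe x) (chartSet x U) := (contDiffOn_chartCoe x).mono htarget
  have h6 : ContDiffOn ℝ ∞ (fun z => fderiv ℝ (chartCoe x) z v) (chartSet x U) :=
    (((contDiffOn_chartCoe x).fderiv_of_isOpen (isOpen_extChartAt_target x) (by simp)).mono
      htarget).clm_apply contDiffOn_const
  exact (R.contDiff.comp_contDiffOn ((contDiff_star_quaternion.comp_contDiffOn h5).mul h6)).prodMk
    contDiffOn_const

/-- Invariance of a form in terms of `dact`. -/
theorem InvariantOn.apply {U : Set M} {φ : ThreeForm} (h : InvariantOn U φ) (g : G) {p : M}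
    (hp : p ∈ U) (v : Fin 3 → E) :
    (φ (act g p) : E [⋀^Fin 3]→L[ℝ] ℝ) (fun i => dact g p (v i)) =
      (φ p : E [⋀^Fin 3]→L[ℝ] ℝ) v :=
  congrArg (fun A : E [⋀^Fin 3]→L[ℝ] ℝ => A v) (h g p hp)

theorem form_congr (φ : ThreeForm) {p q : M} (h : p = q) :
    (φ p : E [⋀^Fin 3]→L[ℝ] ℝ) = (φ q : E [⋀^Fin 3]→L[ℝ] ℝ) := by
  subst h; rfl

theorem InvariantOn.eq_ofFiberForm {U : Set M} {φ : ThreeForm} (h : InvariantOn U φ) {p : M}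
    (hp : p ∈ U) : φ p = ofFiberForm (fiberForm φ) p := by
  refine ContinuousAlternatingMap.ext fun v => ?_
  refine (h.apply (toFiber p) hp v).symm.trans ?_
  exact congrArg (fun A : E [⋀^Fin 3]→L[ℝ] ℝ => A fun i => dact (toFiber p) p (v i))
    (form_congr φ (act_toFiber p))

/-- Invariance of the fibre form under `K⁺ ⊆ G` (the stabilizer of the fibre). -/
theorem InvariantOn.fiberForm_apply {U : Set M} {φ : ThreeForm} (h : InvariantOn U φ) (q q' : Sp1)
    {y : ℍ[ℝ]} (hy : ((1, y) : M) ∈ U) {v w : Fin 3 → E}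
    (h1 : ∀ i, dcoe 1 (w i).1 = (q : ℍ[ℝ]) * dcoe 1 (v i).1 * ((q⁻¹ : Sp1) : ℍ[ℝ]))
    (h2 : ∀ i, (w i).2 = (q' : ℍ[ℝ]) * (v i).2 * ((q⁻¹ : Sp1) : ℍ[ℝ])) :
    fiberForm φ ((q' : ℍ[ℝ]) * y * ((q⁻¹ : Sp1) : ℍ[ℝ])) w = fiberForm φ y v := by
  have ha : act (q, q', q) ((1, y) : M) = (1, (q' : ℍ[ℝ]) * y * ((q⁻¹ : Sp1) : ℍ[ℝ])) := by
    refine Prod.ext ?_ ?_ <;> simp [act]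
  have hw : w = fun i => dact (q, q', q) (1, y) (v i) := by
    funext i
    refine tangent_ext 1 ?_ ?_
    · have h3 := dcoe_dact_fst (q, q', q) (1, y) (v i)
      rw [ha] at h3
      rw [h1, h3]
    · rw [h2, dact_snd]
  refine Eq.trans ?_ (h.apply (q, q', q) hy v)
  rw [hw]
  exact congrArg (fun A : E [⋀^Fin 3]→L[ℝ] ℝ => A fun i => dact (q, q', q) (1, y) (v i))
    (form_congr φ ha.symm)

end Charts

end NPExtension

namespace NPExtension

/-! ### Cutting off smooth functions -/

section Cutoff

/-- A symmetric bump function, equal to `1` up to `ε/3` and zero beyond `ε/2`, preserves parity.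
This makes the division lemmas, which need smoothness on all of `ℝ`, available for functions on
`(-ε, ε)`. -/
theorem exists_contDiff_eq_near_zero {ε : ℝ} (hε : 0 < ε) {k : ℝ → ℝ}
    (hk : ContDiffOn ℝ ∞ k (Set.Ioo (-ε) ε)) :
    ∃ K : ℝ → ℝ, ContDiff ℝ ∞ K ∧ (∀ t ∈ Set.Ioo (-(ε / 3)) (ε / 3), K t = k t) ∧
      ((∀ t ∈ Set.Ioo (-ε) ε, k (-t) = k t) → Function.Even K) ∧
      ((∀ t ∈ Set.Ioo (-ε) ε, k (-t) = -k t) → Function.Odd K) := by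
  let χ : ContDiffBump (0 : ℝ) := ⟨ε / 3, ε / 2, by linarith, by linarith⟩
  have hχ0 : ∀ t : ℝ, ε / 2 ≤ |t| → χ t = 0 := fun t ht =>
    χ.zero_of_le_dist (by simpa [Real.dist_eq] using ht)
  have hout : ∀ t : ℝ, t ∉ Set.Ioo (-ε) ε → χ t = 0 := fun t ht =>
    hχ0 t (by
      by_contra! h
      exact ht (abs_lt.1 (by linarith)))
  have hmem : ∀ t : ℝ, -t ∉ Set.Ioo (-ε) ε ↔ t ∉ Set.Ioo (-ε) ε := fun t => by
    simp only [Set.mem_Ioo, neg_lt_neg_iff, neg_lt, and_comm]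
  refine ⟨fun t => χ t * k t, ?_, ?_, ?_, ?_⟩
  · rw [contDiff_iff_contDiffAt]
    intro t
    by_cases ht : t ∈ Set.Ioo (-ε) ε
    · exact χ.contDiff.contDiffAt.mul (hk.contDiffAt (isOpen_Ioo.mem_nhds ht))
    · have h1 : ε / 2 < |t| := by
        by_contra! h
        exact ht (abs_lt.1 (by linarith))
      have h2 : (fun t => χ t * k t) =ᶠ[nhds t] fun _ => 0 := by
        filter_upwards [(isOpen_lt continuous_const continuous_abs).mem_nhds h1] with s hs
        rw [hχ0 s (le_of_lt hs), zero_mul]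
      exact contDiffAt_const.congr_of_eventuallyEq h2
  · intro t ht
    have : χ t = 1 := χ.one_of_mem_closedBall (by
      simpa [Real.dist_eq] using (abs_lt.2 ht).le)
    simp [this]
  · intro h t
    by_cases ht : t ∈ Set.Ioo (-ε) ε
    · simp only [χ.neg, h t ht]
    · simp only [hout t ht, hout (-t) ((hmem t).2 ht), zero_mul]
  · intro h t
    by_cases ht : t ∈ Set.Ioo (-ε) ε
    · simp only [χ.neg, h t ht, mul_neg]
    · simp only [hout t ht, hout (-t) ((hmem t).2 ht), zero_mul, neg_zero]

theorem eventually_mem_Ioo {ε : ℝ} (hε : 0 < ε) : ∀ᶠ t in nhds (0 : ℝ), t ∈ Set.Ioo (-ε) ε :=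
  isOpen_Ioo.mem_nhds ⟨by linarith, hε⟩

theorem iteratedDeriv_two_sq_mul_of_contDiffOn {ε : ℝ} (hε : 0 < ε) {k : ℝ → ℝ}
    (hk : ContDiffOn ℝ ∞ k (Set.Ioo (-ε) ε)) :
    iteratedDeriv 2 (fun t => t ^ 2 * k t) 0 = 2 * k 0 := by
  obtain ⟨K, hK, hKk, -, -⟩ := exists_contDiff_eq_near_zero hε hk
  have h1 : (fun t => t ^ 2 * k t) =ᶠ[nhds 0] fun t => t ^ 2 * K t := by
    filter_upwards [eventually_mem_Ioo (show 0 < ε / 3 by linarith)] with t ht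
    rw [hKk t ht]
  rw [h1.iteratedDeriv_eq, iteratedDeriv_two_sq_mul hK, hKk 0 ⟨by linarith, by linarith⟩]

theorem deriv_mul_self_of_contDiffOn {ε : ℝ} (hε : 0 < ε) {k : ℝ → ℝ}
    (hk : ContDiffOn ℝ ∞ k (Set.Ioo (-ε) ε)) : deriv (fun t => t * k t) 0 = k 0 := by
  have h1 : DifferentiableAt ℝ k 0 :=
    (hk.contDiffAt (eventually_mem_Ioo hε)).differentiableAt (by simp)
  have := ((hasDerivAt_id (0 : ℝ)).mul h1.hasDerivAt).deriv
  simpa [Pi.mul_def] using this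

theorem eq_at_zero_of_eq_on_pos {ε : ℝ} (hε : 0 < ε) {k l : ℝ → ℝ}
    (hk : ContDiffOn ℝ ∞ k (Set.Ioo (-ε) ε)) (hl : ContDiffOn ℝ ∞ l (Set.Ioo (-ε) ε))
    (h : ∀ t ∈ Set.Ioo 0 ε, k t = l t) : k 0 = l 0 := by
  have hk0 : ContinuousAt k 0 := hk.continuousOn.continuousAt (eventually_mem_Ioo hε)
  have hl0 : ContinuousAt l 0 := hl.continuousOn.continuousAt (eventually_mem_Ioo hε)
  have h1 : Filter.Tendsto k (nhdsWithin 0 (Set.Ioi 0)) (nhds (k 0)) :=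
    hk0.tendsto.mono_left nhdsWithin_le_nhds
  have h2 : Filter.Tendsto l (nhdsWithin 0 (Set.Ioi 0)) (nhds (l 0)) :=
    hl0.tendsto.mono_left nhdsWithin_le_nhds
  refine tendsto_nhds_unique (h1.congr' ?_) h2
  filter_upwards [Ioo_mem_nhdsGT hε] with t ht using h t ht

theorem exists_real_pos_le {T : EReal} (hT : 0 < T) : ∃ ε : ℝ, 0 < ε ∧ (ε : EReal) ≤ T := by
  obtain ⟨ε, h1, h2⟩ := EReal.lt_iff_exists_real_btwn.1 hT
  exact ⟨ε, by exact_mod_cast h1, h2.le⟩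

end Cutoff

/-! ### Components along `γ` -/

section Components

/-- The frame along `γ` in the coordinates of `E`. -/
noncomputable def frameE (t : ℝ) : Fin 7 → E :=
  ![(0, 1), (0, (-3 * t) • sp1Basis 0), (0, (-3 * t) • sp1Basis 1), (0, (-3 * t) • sp1Basis 2),
    ((-3 : ℝ) • imVec 0, 0), ((-3 : ℝ) • imVec 1, 0), ((-3 : ℝ) • imVec 2, 0)]

theorem HasComponents.fiberForm_apply {T : EReal} {φ : ThreeForm} {f : Fin 5 → ℝ → ℝ}
    (hf : HasComponents T φ f) {t : ℝ} (h0 : 0 < t) (hT : (t : EReal) < T)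
    (c : Fin 3 → Fin 7 → ℝ) :
    fiberForm φ (t : ℍ[ℝ]) (fun a => ∑ i, c a i • frameE t i) = phiInv (fun k => f k t) c := by
  rw [← hf t h0 hT c]
  have h : (frame t : Fin 7 → E) = frameE t := frame_eq t
  rw [← h]
  rfl

theorem HasComponents.fiberForm_basis {T : EReal} {φ : ThreeForm} {f : Fin 5 → ℝ → ℝ}
    (hf : HasComponents T φ f) {t : ℝ} (h0 : 0 < t) (hT : (t : EReal) < T) (i j k : Fin 7) :
    fiberForm φ (t : ℍ[ℝ]) ![frameE t i, frameE t j, frameE t k] =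
      phiInv (fun k => f k t) ![Pi.single i 1, Pi.single j 1, Pi.single k 1] := by
  rw [← hf.fiberForm_apply h0 hT]
  congr 1
  funext a
  fin_cases a <;> simp [Pi.single_apply]

theorem contDiff_coe_quaternion : ContDiff ℝ ∞ (fun t : ℝ => (t : ℍ[ℝ])) := by
  have e : (fun t : ℝ => (t : ℍ[ℝ])) = fun t : ℝ => t • (1 : ℍ[ℝ]) := by
    funext t
    ext <;> simp
  rw [e]
  exact contDiff_id.smul contDiff_const

theorem mem_tube_one {T : EReal} {y : ℍ[ℝ]} : ((1, y) : M) ∈ tube T ↔ ((‖y‖ : ℝ) : EReal) < T :=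
  Iff.rfl

theorem coe_mem_tube {T : EReal} {ε : ℝ} (hεT : (ε : EReal) ≤ T) {t : ℝ}
    (ht : t ∈ Set.Ioo (-ε) ε) : ((1, (t : ℍ[ℝ])) : M) ∈ tube T := by
  rw [mem_tube_one, Quaternion.norm_coe, Real.norm_eq_abs]
  exact lt_of_lt_of_le (by exact_mod_cast abs_lt.2 ht) hεT

theorem coe_mem_regularTube {T : EReal} {ε : ℝ} (hεT : (ε : EReal) ≤ T) {t : ℝ}
    (ht : t ∈ Set.Ioo 0 ε) : ((1, (t : ℍ[ℝ])) : M) ∈ regularTube T :=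
  ⟨coe_mem_tube hεT ⟨by linarith [ht.1, ht.2], ht.2⟩, fun h =>
    ht.1.ne' (by simpa using congrArg QuaternionAlgebra.re h)⟩

end Components

/-! ### Necessity of the conditions -/

section Necessity

variable {T : EReal} {φ ψ : ThreeForm} {f : Fin 5 → ℝ → ℝ}

/-- The vector `v ∈ ℍ` tangent to the fibre. -/
noncomputable def vert (y : ℍ[ℝ]) : E := (0, y)

/-- The vector `i, j, k` tangent to the base. -/
noncomputable def horiz (a : Fin 3) : E := (imVec a, 0)

theorem contDiffOn_fiberForm_real (hs : SmoothOn (tube T) ψ) {ε : ℝ} (hεT : (ε : EReal) ≤ T)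
    (v : Fin 3 → E) :
    ContDiffOn ℝ ∞ (fun t : ℝ => fiberForm ψ (t : ℍ[ℝ]) v) (Set.Ioo (-ε) ε) := by
  have h1 := hs.contDiffOn_fiberForm.comp contDiff_coe_quaternion.contDiffOn
    (s := Set.Ioo (-ε) ε) fun t ht => coe_mem_tube hεT ht
  exact contDiffOn_alternating_iff.1 h1 v

/-- The element `(1, -1, 1)` fixes the sphere and acts by `-1` on the fibre; it is the source of all
parity statements. -/
theorem fiberForm_neg (hi : InvariantOn (tube T) ψ) {y : ℍ[ℝ]} (hy : ((1, y) : M) ∈ tube T)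
    {v w : Fin 3 → E} (h1 : ∀ i, (w i).1 = (v i).1) (h2 : ∀ i, (w i).2 = -(v i).2) :
    fiberForm ψ (-y) w = fiberForm ψ y v := by
  have h := hi.fiberForm_apply 1 (-1) hy (v := v) (w := w) (fun i => by simp [h1])
    (fun i => by simp [h2])
  simpa using h

theorem frameE_vert (t : ℝ) (a : Fin 3) :
    frameE t (![1, 2, 3] a) = (-3 * t) • vert (sp1Basis a) := by
  fin_cases a <;> simp [frameE, vert]

theorem frameE_horiz (t : ℝ) (a : Fin 3) :
    frameE t (![4, 5, 6] a) = (-3 : ℝ) • horiz a := by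
  fin_cases a <;> simp [frameE, horiz]

/-- The values of the extended form at the singular orbit. -/
theorem fiberForm_zero_vert (hf : HasComponents T φ f) (hT : 0 < T)
    (hs : SmoothOn (tube T) ψ) (hψ : ∀ p ∈ regularTube T, ψ p = φ p) (a b : Fin 3) :
    fiberForm ψ 0 ![vert 1, vert (sp1Basis a), horiz b] =
      if a = b then fiberForm ψ 0 ![vert 1, vert (sp1Basis 0), horiz 0] else 0 := by
  obtain ⟨ε, hε, hεT⟩ := exists_real_pos_le hT
  -- The factor is `(-3t)(-3)`, from one vertical and one horizontal frame vector. Dividing by `t`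
  -- and letting `t → 0` gives the claim.
  have hA : ∀ a b, ∀ t ∈ Set.Ioo 0 ε,
      9 * t * fiberForm ψ (t : ℍ[ℝ]) ![vert 1, vert (sp1Basis a), horiz b] =
      if a = b then f 0 t else 0 := by
    intro a b t ht
    have htT : (t : EReal) < T := lt_of_lt_of_le (by exact_mod_cast ht.2) hεT
    have hreg : ((1, (t : ℍ[ℝ])) : M) ∈ regularTube T := coe_mem_regularTube hεT ht
    have h1 := hf.fiberForm_basis ht.1 htT 0 (![1, 2, 3] a) (![4, 5, 6] b)
    rw [frameE_vert, frameE_horiz, map_smul_one, map_smul_two] at h1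
    have h2 : fiberForm ψ (t : ℍ[ℝ]) = fiberForm φ (t : ℍ[ℝ]) := hψ _ hreg
    have h3 : frameE t 0 = vert 1 := rfl
    rw [h2, show (9 * t : ℝ) = -3 * t * -3 by ring, mul_assoc, ← h3, h1]
    fin_cases a <;> fin_cases b <;> simp [phiInv, wedge3_apply]
  have hS := fun a b => contDiffOn_fiberForm_real hs hεT ![vert 1, vert (sp1Basis a), horiz b]
  split_ifs with hab
  · have := eq_at_zero_of_eq_on_pos hε (hS a b) (hS 0 0) fun t ht => by
      have h1 := hA a b t ht
      have h2 := hA 0 0 t ht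
      rw [if_pos hab] at h1
      rw [if_pos rfl] at h2
      have h3 : (9 * t : ℝ) ≠ 0 := by have := ht.1; positivity
      exact mul_left_cancel₀ h3 (h1.trans h2.symm)
    simpa using this
  · have := eq_at_zero_of_eq_on_pos hε (hS a b) (contDiffOn_const (c := (0 : ℝ))) fun t ht => by
      have h1 := hA a b t ht
      rw [if_neg hab] at h1
      have h3 : (9 * t : ℝ) ≠ 0 := by have := ht.1; positivity
      exact (mul_eq_zero.1 h1).resolve_left h3
    simpa using this

/-- The origin is fixed by `-1`, so components with an odd number of vertical arguments vanish
there. -/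
theorem fiberForm_zero_eq_zero (hT : 0 < T) (hi : InvariantOn (tube T) ψ) {v w : Fin 3 → E}
    (h1 : ∀ i, (w i).1 = (v i).1) (h2 : ∀ i, (w i).2 = -(v i).2)
    (h3 : fiberForm ψ 0 w = -fiberForm ψ 0 v) : fiberForm ψ 0 v = 0 := by
  have hy : ((1, 0) : M) ∈ tube T := by rw [mem_tube_one]; simpa using hT
  have := fiberForm_neg hi hy h1 h2
  rw [neg_zero, h3] at this
  linarith

theorem decompose (z : E) : z = ∑ a, imCoord z.1 a • horiz a + z.2.re • vert 1 +
    z.2.imI • vert (sp1Basis 0) + z.2.imJ • vert (sp1Basis 1) + z.2.imK • vert (sp1Basis 2) := by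
  refine Prod.ext ?_ ?_
  · simpa [horiz, vert, Prod.fst_sum] using (sum_imCoord z.1).symm
  · ext <;> simp [horiz, vert, Prod.snd_sum, sp1Basis_re, sp1Basis_imI, sp1Basis_imJ, sp1Basis_imK]

theorem horiz_ne_zero (a : Fin 3) : horiz a ≠ 0 := by
  intro h
  have h1 : imVec a = 0 := congrArg Prod.fst h
  have h2 := dcoe_imVec a
  rw [h1, map_zero] at h2
  have h3 := congrArg QuaternionAlgebra.imI h2
  have h4 := congrArg QuaternionAlgebra.imJ h2
  have h5 := congrArg QuaternionAlgebra.imK h2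
  rw [sp1Basis_imI] at h3
  rw [sp1Basis_imJ] at h4
  rw [sp1Basis_imK] at h5
  fin_cases a <;> simp at h3 h4 h5

theorem map_eq_zero_of_eq_one_two (A : E [⋀^Fin 3]→L[ℝ] ℝ) (x y : E) : A ![x, y, y] = 0 :=
  A.map_eq_zero_of_eq ![x, y, y] (i := 1) (j := 2) rfl (by decide)

theorem map_eq_zero_of_eq_zero_two (A : E [⋀^Fin 3]→L[ℝ] ℝ) (x y : E) : A ![x, y, x] = 0 :=
  A.map_eq_zero_of_eq ![x, y, x] (i := 0) (j := 2) rfl (by decide)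

theorem map_swap_one_two (A : E [⋀^Fin 3]→L[ℝ] ℝ) (x y z : E) :
    A ![x, y, z] = -A ![x, z, y] := by
  have h := map_eq_zero_of_eq_one_two A x (y + z)
  rw [map_add_one, map_add_two, map_add_two, map_eq_zero_of_eq_one_two,
    map_eq_zero_of_eq_one_two] at h
  linarith

/-- Otherwise the first two horizontal vectors would have zero cross product, since their pairing
with vertical vectors is odd under `-1`. This yields `f₂(0) ≠ 0`. -/
theorem fiberForm_zero_horiz_ne_zero (hT : 0 < T) (hi : InvariantOn (tube T) ψ)
    (hp : IsPositive (fiberForm ψ 0)) :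
    fiberForm ψ 0 ![horiz 0, horiz 1, horiz 2] ≠ 0 := by
  intro h0
  have hvert : ∀ y, fiberForm ψ 0 ![horiz 0, horiz 1, vert y] = 0 := fun y =>
    fiberForm_zero_eq_zero hT hi (w := ![horiz 0, horiz 1, vert (-y)])
      (fun i => by fin_cases i <;> rfl) (fun i => by fin_cases i <;> simp [horiz, vert])
      (by rw [show vert (-y) = (-1 : ℝ) • vert y by simp [vert], map_smul_two]; ring)
  obtain ⟨r, hr⟩ := hp.exists_eq_smul (x := horiz 0) (y := horiz 1) (horiz_ne_zero 0) fun z => by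
    rw [decompose z]
    simp only [Fin.sum_univ_three, map_add_two, map_smul_two, hvert, h0,
      map_eq_zero_of_eq_one_two, map_eq_zero_of_eq_zero_two]
    ring
  have h1 : imVec 1 = r • imVec 0 := congrArg Prod.fst hr
  have h2 := dcoe_imVec 1
  rw [h1, map_smul, dcoe_imVec] at h2
  have h3 := congrArg QuaternionAlgebra.imJ h2
  have h4 : (r • sp1Basis 0).imJ = r * (sp1Basis 0).imJ := by simp
  rw [h4, sp1Basis_imJ, sp1Basis_imJ] at h3
  simp at h3

/-- Otherwise `1` vertical and `i` horizontal would have zero cross product. This yields `f₀'(0) ≠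
0`. -/
theorem fiberForm_zero_vert_ne_zero (hf : HasComponents T φ f) (hT : 0 < T)
    (hs : SmoothOn (tube T) ψ) (hψ : ∀ p ∈ regularTube T, ψ p = φ p)
    (hi : InvariantOn (tube T) ψ) (hp : IsPositive (fiberForm ψ 0)) :
    fiberForm ψ 0 ![vert 1, vert (sp1Basis 0), horiz 0] ≠ 0 := by
  intro h0
  have hv : ∀ a b, fiberForm ψ 0 ![vert 1, horiz b, vert (sp1Basis a)] = 0 := fun a b => by
    rw [map_swap_one_two, fiberForm_zero_vert hf hT hs hψ, h0]
    simp
  have hh : ∀ a b, fiberForm ψ 0 ![vert 1, horiz a, horiz b] = 0 := fun a b =>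
    fiberForm_zero_eq_zero hT hi (w := ![vert (-1), horiz a, horiz b])
      (fun i => by fin_cases i <;> rfl) (fun i => by fin_cases i <;> simp [horiz, vert])
      (by rw [show vert (-1) = (-1 : ℝ) • vert 1 by simp [vert], map_smul_zero]; ring)
  have hne : vert 1 ≠ 0 := fun h => one_ne_zero (α := ℍ[ℝ]) (congrArg Prod.snd h)
  obtain ⟨r, hr⟩ := hp.exists_eq_smul (x := vert 1) (y := horiz 0) hne fun z => by
    rw [decompose z]
    simp only [Fin.sum_univ_three, map_add_two, map_smul_two, hv, hh,
      map_eq_zero_of_eq_zero_two]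
    ring
  have h1 : imVec 0 = r • (0 : EuclideanSpace ℝ (Fin 3)) := congrArg Prod.fst hr
  exact horiz_ne_zero 0 (Prod.ext (by rw [smul_zero] at h1; exact h1) rfl)

/-- Invariance under left multiplication by `i` relates the two vertical components. -/
theorem fiberForm_zero_quarter_turn (hT : 0 < T) (hi : InvariantOn (tube T) ψ) :
    fiberForm ψ 0 ![vert (sp1Basis 0), vert (sp1Basis 1), horiz 2] =
      -fiberForm ψ 0 ![vert 1, vert (sp1Basis 2), horiz 2] := by
  have hy : ((1, 0) : M) ∈ tube T := by rw [mem_tube_one]; simpa using hT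
  let q' : Sp1 := ⟨sp1Basis 0, by
    have h : ‖sp1Basis 0‖ * ‖sp1Basis 0‖ = 1 := by
      rw [← Quaternion.normSq_eq_norm_mul_self, Quaternion.normSq_def']
      simp [sp1Basis_re, sp1Basis_imI, sp1Basis_imJ, sp1Basis_imK]
    have h2 : ‖sp1Basis 0‖ = 1 := by nlinarith [norm_nonneg (sp1Basis 0)]
    simpa using h2⟩
  -- Left multiplication by `i` sends `1` to `i` and `k` to `-j`.
  have h := hi.fiberForm_apply 1 q' hy (v := ![vert 1, vert (sp1Basis 2), horiz 2])
    (w := ![vert (sp1Basis 0), (-1 : ℝ) • vert (sp1Basis 1), horiz 2])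
    (fun i => by fin_cases i <;> simp [vert])
    (fun i => by
      fin_cases i
      · simp [vert, q']
      · ext <;> simp [vert, q', sp1Basis_re, sp1Basis_imI, sp1Basis_imJ, sp1Basis_imK]
      · simp [horiz])
  rw [map_smul_one] at h
  simp only [mul_zero, zero_mul] at h
  linarith

/-- The indices of the frame vectors defining the component functions. -/
def componentIndex : Fin 5 → Fin 3 → Fin 7 :=
  ![![0, 1, 4], ![1, 2, 3], ![4, 5, 6], ![1, 2, 6], ![1, 5, 6]]

/-- The component functions of a form along the full line through `γ`. -/
noncomputable def componentFun (ψ : ThreeForm) (k : Fin 5) (t : ℝ) : ℝ :=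
  fiberForm ψ (t : ℍ[ℝ]) ![frameE t (componentIndex k 0), frameE t (componentIndex k 1),
    frameE t (componentIndex k 2)]

theorem contDiff_frameE (i : Fin 7) : ContDiff ℝ ∞ (fun t => frameE t i) := by
  fin_cases i
  · exact contDiff_const
  · exact contDiff_const.prodMk ((contDiff_const.mul contDiff_id).smul contDiff_const)
  · exact contDiff_const.prodMk ((contDiff_const.mul contDiff_id).smul contDiff_const)
  · exact contDiff_const.prodMk ((contDiff_const.mul contDiff_id).smul contDiff_const)
  · exact contDiff_const
  · exact contDiff_const
  · exact contDiff_const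

theorem frameE_neg_snd (t : ℝ) {i : Fin 7} (hi : i ≠ 0) :
    (frameE (-t) i).1 = (frameE t i).1 ∧ (frameE (-t) i).2 = -(frameE t i).2 := by
  fin_cases i
  · exact absurd rfl hi
  all_goals simp [frameE]

theorem extensionConditions_of_extension (hT : 0 < T) (hf : HasComponents T φ f)
    (hψ : ∀ p ∈ regularTube T, ψ p = φ p) (hi : InvariantOn (tube T) ψ)
    (hnp : IsNearlyParallel (tube T) ψ) : ExtensionConditions T f := by
  have hs := hnp.smooth
  have hp : IsPositive (fiberForm ψ 0) := hnp.positive (1, 0) (by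
    rw [mem_tube_one]; simpa using hT)
  obtain ⟨ε, hε, hεT⟩ := exists_real_pos_le hT
  have hS := fun v => contDiffOn_fiberForm_real hs hεT v
  have e0 : ∀ t, frameE t 0 = vert 1 := fun t => rfl
  have e1 : ∀ t, frameE t 1 = (-3 * t) • vert (sp1Basis 0) := fun t => frameE_vert t 0
  have e2 : ∀ t, frameE t 2 = (-3 * t) • vert (sp1Basis 1) := fun t => frameE_vert t 1
  have e3 : ∀ t, frameE t 3 = (-3 * t) • vert (sp1Basis 2) := fun t => frameE_vert t 2
  have e4 : ∀ t, frameE t 4 = (-3 : ℝ) • horiz 0 := fun t => frameE_horiz t 0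
  have e5 : ∀ t, frameE t 5 = (-3 : ℝ) • horiz 1 := fun t => frameE_horiz t 1
  have e6 : ∀ t, frameE t 6 = (-3 : ℝ) • horiz 2 := fun t => frameE_horiz t 2
  have c0 : componentFun ψ 0 = fun t : ℝ => t * (9 *
      fiberForm ψ (t : ℍ[ℝ]) ![vert 1, vert (sp1Basis 0), horiz 0]) := by
    funext t
    simp only [componentFun, componentIndex, Matrix.cons_val, e0, e1, e4]
    simp only [map_smul_one, map_smul_two]
    ring
  -- Three vertical vectors contribute `t³`; the spare factor `t` inside the bracket kills the
  -- second derivative at `0`.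
  have c1 : componentFun ψ 1 = fun t : ℝ => t ^ 2 * (-27 * t *
      fiberForm ψ (t : ℍ[ℝ]) ![vert (sp1Basis 0), vert (sp1Basis 1), vert (sp1Basis 2)]) := by
    funext t
    simp only [componentFun, componentIndex, Matrix.cons_val, e1, e2, e3]
    simp only [map_smul_zero, map_smul_one, map_smul_two]
    ring
  have c2 : componentFun ψ 2 = fun t : ℝ => (-27 *
      fiberForm ψ (t : ℍ[ℝ]) ![horiz 0, horiz 1, horiz 2]) := by
    funext t
    simp only [componentFun, componentIndex, Matrix.cons_val, e4, e5, e6]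
    simp only [map_smul_zero, map_smul_one, map_smul_two]
    ring
  have c3 : componentFun ψ 3 = fun t : ℝ => t ^ 2 * (-27 *
      fiberForm ψ (t : ℍ[ℝ]) ![vert (sp1Basis 0), vert (sp1Basis 1), horiz 2]) := by
    funext t
    simp only [componentFun, componentIndex, Matrix.cons_val, e1, e2, e6]
    simp only [map_smul_zero, map_smul_one, map_smul_two]
    ring
  have c4 : componentFun ψ 4 = fun t : ℝ => t * (-27 *
      fiberForm ψ (t : ℍ[ℝ]) ![vert (sp1Basis 0), horiz 1, horiz 2]) := by
    funext t
    simp only [componentFun, componentIndex, Matrix.cons_val, e1, e5, e6]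
    simp only [map_smul_zero, map_smul_one, map_smul_two]
    ring
  have d0 : deriv (componentFun ψ 0) 0 =
      9 * fiberForm ψ 0 ![vert 1, vert (sp1Basis 0), horiz 0] := by
    rw [c0, deriv_mul_self_of_contDiffOn hε (contDiffOn_const.mul (hS _))]
    simp
  refine ⟨ε, hε, hεT, componentFun ψ, ?_, ?_, ?_, ?_, ?_, ?_, ?_, ?_, ?_, ?_, ?_⟩
  · intro k
    have h1 := hs.contDiffOn_fiberForm.comp contDiff_coe_quaternion.contDiffOn
      (s := Set.Ioo (-ε) ε) fun t ht => coe_mem_tube hεT ht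
    exact contDiffOn_alternating_apply h1
      (v := ![fun t => frameE t (componentIndex k 0), fun t => frameE t (componentIndex k 1),
        fun t => frameE t (componentIndex k 2)])
      (fun i => by
        fin_cases i
        · exact (contDiff_frameE _).contDiffOn
        · exact (contDiff_frameE _).contDiffOn
        · exact (contDiff_frameE _).contDiffOn) |>.congr fun t _ => by
          simp only [componentFun, Function.comp_apply]
          congr 1
          funext i
          fin_cases i <;> rfl
  · intro k t ht
    have htT : (t : EReal) < T := lt_of_lt_of_le (by exact_mod_cast ht.2) hεT
    have hreg : ((1, (t : ℍ[ℝ])) : M) ∈ regularTube T := coe_mem_regularTube hεT ht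
    have h2 : fiberForm ψ (t : ℍ[ℝ]) = fiberForm φ (t : ℍ[ℝ]) := hψ _ hreg
    rw [componentFun, h2, hf.fiberForm_basis ht.1 htT]
    fin_cases k <;> simp [phiInv, wedge3_apply, componentIndex]
  · intro t ht
    -- The map `-1` carries the frame at `t` to the frame at `-t`, except that `e₁` changes sign:
    -- hence `f₀` is odd and the others are even.
    have h1 := fiberForm_neg hi (coe_mem_tube hεT ht)
      (v := ![frameE t 0, frameE t 1, frameE t 4])
      (w := ![(-1 : ℝ) • frameE (-t) 0, frameE (-t) 1, frameE (-t) 4])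
      (fun i => by fin_cases i <;> simp [frameE]) (fun i => by fin_cases i <;> simp [frameE])
    rw [map_smul_zero] at h1
    simp only [componentFun, componentIndex, Matrix.cons_val, Quaternion.coe_neg]
    linarith
  · intro k hk t ht
    have hne : ∀ a, componentIndex k a ≠ 0 := by
      revert k
      decide
    simp only [componentFun, Quaternion.coe_neg]
    exact fiberForm_neg hi (coe_mem_tube hεT ht)
      (fun i => by
        fin_cases i
        · exact (frameE_neg_snd t (hne 0)).1
        · exact (frameE_neg_snd t (hne 1)).1
        · exact (frameE_neg_snd t (hne 2)).1)
      (fun i => by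
        fin_cases i
        · exact (frameE_neg_snd t (hne 0)).2
        · exact (frameE_neg_snd t (hne 1)).2
        · exact (frameE_neg_snd t (hne 2)).2)
  · simp [c1]
  · simp [c3]
  · simp [c4]
  · rw [c1, iteratedDeriv_two_sq_mul_of_contDiffOn hε
      (((contDiff_const (c := (-27 : ℝ))).mul contDiff_fun_id).contDiffOn.mul (hS _))]
    simp
  -- With `A` the common mixed component at the origin, `F₀'(0) = 9A` and `F₃''(0) = 2 · (-27) ·
  -- (-A) = 54A`.
  · rw [d0, c3, iteratedDeriv_two_sq_mul_of_contDiffOn hε (contDiffOn_const.mul (hS _))]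
    rw [Quaternion.coe_zero, fiberForm_zero_quarter_turn hT hi,
      fiberForm_zero_vert hf hT hs hψ 2 2, if_pos rfl]
    ring
  · simp only [c2, Quaternion.coe_zero]
    exact mul_ne_zero (by norm_num) (fiberForm_zero_horiz_ne_zero hT hi hp)
  · rw [d0]
    exact mul_ne_zero (by norm_num) (fiberForm_zero_vert_ne_zero hf hT hs hψ hi hp)

end Necessity

end NPExtension

namespace NPExtension

/-! ### Smooth extension of the fibre form -/

section FiberCoordinates

/-- The coordinates of a tangent vector of `M` at a point of `{1} × ℍ`: four vertical ones and
three horizontal ones. -/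
noncomputable def fiberCoord (z : E) : Fin 7 → ℝ :=
  ![z.2.re, z.2.imI, z.2.imJ, z.2.imK, imCoord z.1 0, imCoord z.1 1, imCoord z.1 2]

theorem imCoord_sum (c : Fin 3 → ℝ) : imCoord (∑ a, c a • imVec a) = c := by
  have h : dcoe 1 (∑ a, c a • imVec a) = ∑ a, c a • sp1Basis a := by
    simp only [map_sum, map_smul, dcoe_imVec]
  funext b
  rw [imCoord, h, Fin.sum_univ_three]
  fin_cases b <;> simp [sp1Basis_imI, sp1Basis_imJ, sp1Basis_imK]

/-- The coordinate system `fiberCoord`. -/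
noncomputable def fiberCoordEquiv : E ≃ₗ[ℝ] (Fin 7 → ℝ) where
  toFun := fiberCoord
  invFun c := (∑ a, ![c 4, c 5, c 6] a • imVec a, ⟨c 0, c 1, c 2, c 3⟩)
  map_add' z w := by
    funext i
    fin_cases i <;> simp [fiberCoord, imCoord]
  map_smul' r z := by
    funext i
    fin_cases i <;> simp [fiberCoord, imCoord]
  left_inv z := by
    refine Prod.ext ?_ ?_
    · refine Eq.trans ?_ (sum_imCoord z.1)
      simp [fiberCoord, Fin.sum_univ_three]
    · rfl
  right_inv c := by
    funext i
    simp only [fiberCoord, imCoord_sum]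
    fin_cases i <;> rfl

theorem fiberCoordEquiv_apply (z : E) : fiberCoordEquiv z = fiberCoord z := rfl

/-- The basis of `E` with coordinates `fiberCoord`. -/
noncomputable def fiberBasis : Module.Basis (Fin 7) ℝ E := Module.Basis.ofEquivFun fiberCoordEquiv

theorem fiberCoord_sum_frameE (t : ℝ) (c : Fin 7 → ℝ) : fiberCoord (∑ i, c i • frameE t i) =
    ![c 0, -3 * t * c 1, -3 * t * c 2, -3 * t * c 3, -3 * c 4, -3 * c 5, -3 * c 6] := by
  have h : ∑ i, c i • frameE t i = (∑ a, ![-3 * c 4, -3 * c 5, -3 * c 6] a • imVec a,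
      ⟨c 0, -3 * t * c 1, -3 * t * c 2, -3 * t * c 3⟩) := by
    refine Prod.ext ?_ ?_
    · simp [frameE, Fin.sum_univ_seven, Fin.sum_univ_three, smul_smul, mul_comm]
    · ext <;> simp [frameE, Fin.sum_univ_seven, sp1Basis_re, sp1Basis_imI,
        sp1Basis_imJ, sp1Basis_imK] <;> ring
  rw [h]
  funext i
  simp only [fiberCoord, imCoord_sum]
  fin_cases i <;> rfl

theorem eq_sum_frameE {t : ℝ} (ht : t ≠ 0) (z : E) {c : Fin 7 → ℝ}
    (h0 : c 0 = fiberCoord z 0)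
    (h1 : ∀ i : Fin 7, i ∈ ({1, 2, 3} : Finset (Fin 7)) → c i = -(fiberCoord z i / (3 * t)))
    (h2 : ∀ i : Fin 7, i ∈ ({4, 5, 6} : Finset (Fin 7)) → c i = -(fiberCoord z i / 3)) :
    z = ∑ i, c i • frameE t i := by
  apply fiberCoordEquiv.injective
  rw [fiberCoordEquiv_apply, fiberCoordEquiv_apply, fiberCoord_sum_frameE, h0, h1 1 (by decide),
    h1 2 (by decide), h1 3 (by decide), h2 4 (by decide), h2 5 (by decide), h2 6 (by decide)]
  funext i
  fin_cases i <;> simp <;> field_simp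

theorem linearIndependent_frameE {t : ℝ} (ht : t ≠ 0) : LinearIndependent ℝ (frameE t) := by
  rw [Fintype.linearIndependent_iff]
  intro c hc
  have h := fiberCoord_sum_frameE t c
  rw [hc, ← fiberCoordEquiv_apply, map_zero] at h
  intro i
  have hi := congrFun h i
  fin_cases i <;> simpa [ht] using hi.symm

/-- The coordinates of a vector tangent to `{1} × ℍ` at `(1, y)` after rotating `y` to the real
axis, up to the factor `‖y‖` in the vertical coordinates. -/
noncomputable def rotCoord (y : ℍ[ℝ]) (z : E) : Fin 7 → ℝ := fiberCoord (z.1, star y * z.2)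

theorem rotCoord_horiz (y : ℍ[ℝ]) (z : E) :
    rotCoord y z 4 = fiberCoord z 4 ∧ rotCoord y z 5 = fiberCoord z 5 ∧
      rotCoord y z 6 = fiberCoord z 6 := ⟨rfl, rfl, rfl⟩

theorem contDiff_linear (L : ℍ[ℝ] →ₗ[ℝ] ℝ) : ContDiff ℝ ∞ L :=
  (LinearMap.toContinuousLinearMap L).contDiff

theorem contDiff_rotCoord (z : E) (i : Fin 7) : ContDiff ℝ ∞ fun y => rotCoord y z i := by
  have h : ContDiff ℝ ∞ fun y : ℍ[ℝ] => star y * z.2 :=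
    contDiff_star_quaternion.mul contDiff_const
  have hL := fun L : ℍ[ℝ] →ₗ[ℝ] ℝ => (contDiff_linear L).comp h
  fin_cases i
  · exact hL (QuaternionAlgebra.reₗ _ _ _)
  · exact hL (QuaternionAlgebra.imIₗ _ _ _)
  · exact hL (QuaternionAlgebra.imJₗ _ _ _)
  · exact hL (QuaternionAlgebra.imKₗ _ _ _)
  · exact contDiff_const (c := fiberCoord z 4)
  · exact contDiff_const (c := fiberCoord z 5)
  · exact contDiff_const (c := fiberCoord z 6)

theorem contDiff_wedge3 {W : Type*} [NormedAddCommGroup W] [NormedSpace ℝ W]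
    {c : W → Fin 3 → Fin 7 → ℝ} (hc : ∀ k i, ContDiff ℝ ∞ fun y => c y k i) (i j k : Fin 7) :
    ContDiff ℝ ∞ fun y => wedge3 i j k (c y) := by
  simp only [wedge3_apply]
  fun_prop

/-- The volume form of `ℍ` contracted with `y`. -/
noncomputable def contractedVol (y : ℍ[ℝ]) (d : Fin 3 → Fin 7 → ℝ) : ℝ :=
  y.re * wedge3 1 2 3 d - y.imI * wedge3 0 2 3 d + y.imJ * wedge3 0 1 3 d
    - y.imK * wedge3 0 1 2 d

theorem sq_norm_quaternion (y : ℍ[ℝ]) :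
    ‖y‖ ^ 2 = y.re ^ 2 + y.imI ^ 2 + y.imJ ^ 2 + y.imK ^ 2 := by
  rw [sq, ← Quaternion.normSq_eq_norm_mul_self, Quaternion.normSq_def']

/-- The map `L z = ȳ z` has determinant `|y|⁴` and `L(y/|y|²) = 1`, so it pulls the contraction of
the volume form with `1` back to `|y|²` times the one with `y`. This gain reduces `f₁/t⁶` to
`f₁/t⁴`. -/
theorem wedge3_rotCoord (y : ℍ[ℝ]) (v : Fin 3 → E) :
    wedge3 1 2 3 (fun k => rotCoord y (v k)) =
      ‖y‖ ^ 2 * contractedVol y fun k => fiberCoord (v k) := by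
  rw [sq_norm_quaternion]
  simp only [contractedVol, wedge3_apply, rotCoord, fiberCoord, Matrix.cons_val]
  simp
  ring

/-- The part of `phiInv` with coefficient `f₀`. -/
def wedgeMixed (c : Fin 3 → Fin 7 → ℝ) : ℝ := wedge3 0 1 4 c + wedge3 0 2 5 c + wedge3 0 3 6 c

/-- The part of `phiInv` with coefficient `f₃`. -/
def wedgeRot (c : Fin 3 → Fin 7 → ℝ) : ℝ := wedge3 1 2 6 c - wedge3 1 3 5 c + wedge3 2 3 4 c

/-- The difference involves only the three 2-forms `ω_a`, which are invariant under left
multiplication by unit quaternions and so scale by `|y|²` under `z ↦ ȳ z`. -/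
theorem wedgeMixed_sub_wedgeRot (y : ℍ[ℝ]) (v : Fin 3 → E) :
    wedgeMixed (fun k => rotCoord y (v k)) - wedgeRot (fun k => rotCoord y (v k)) =
      ‖y‖ ^ 2 * hyperkaehlerForm 0 1 fun k => fiberCoord (v k) := by
  rw [sq_norm_quaternion]
  simp only [wedgeMixed, wedgeRot, hyperkaehlerForm, wedge3_apply, rotCoord, fiberCoord,
    Matrix.cons_val]
  simp
  ring

/-- The smooth expression for an invariant form on the fibre in terms of the smooth even functions
`a₀ = f₀/t`, `a₁ = f₁/t⁴`, `f₂`, `a₃ = f₃/t²`, `a₄ = f₄/t²` and `b = (3a₀ - a₃)/t²`. -/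
noncomputable def smoothFiberForm (a : Fin 5 → ℝ → ℝ) (b : ℝ → ℝ) (v : Fin 3 → E) (y : ℍ[ℝ]) : ℝ :=
  b ‖y‖ * ((wedgeMixed (fun k => rotCoord y (v k)) + wedgeRot (fun k => rotCoord y (v k))) / 54)
    + (3 * a 0 ‖y‖ + a 3 ‖y‖) * (hyperkaehlerForm 0 1 (fun k => fiberCoord (v k)) / 54)
    - a 1 ‖y‖ * (contractedVol y (fun k => fiberCoord (v k)) / 27)
    - a 2 ‖y‖ * (wedge3 4 5 6 (fun k => fiberCoord (v k)) / 27)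
    - a 4 ‖y‖ * ((wedge3 1 5 6 (fun k => rotCoord y (v k)) -
      wedge3 2 4 6 (fun k => rotCoord y (v k)) + wedge3 3 4 5 (fun k => rotCoord y (v k))) / 27)

theorem contDiff_smoothFiberForm {a : Fin 5 → ℝ → ℝ} {b : ℝ → ℝ} (ha : ∀ k, ContDiff ℝ ∞ (a k))
    (ha' : ∀ k, Function.Even (a k)) (hb : ContDiff ℝ ∞ b) (hb' : Function.Even b)
    (v : Fin 3 → E) : ContDiff ℝ ∞ (smoothFiberForm a b v) := by
  have h1 : ∀ k, ContDiff ℝ ∞ fun y : ℍ[ℝ] => a k ‖y‖ := fun k =>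
    contDiff_comp_norm_of_even (ha k) (ha' k)
  have h2 : ContDiff ℝ ∞ fun y : ℍ[ℝ] => b ‖y‖ := contDiff_comp_norm_of_even hb hb'
  have h3 : ∀ i j k, ContDiff ℝ ∞ fun y => wedge3 i j k fun k => rotCoord y (v k) :=
    contDiff_wedge3 fun k i => contDiff_rotCoord (v k) i
  have h4 : ContDiff ℝ ∞ fun y => contractedVol y fun k => fiberCoord (v k) := by
    have e1 : ContDiff ℝ ∞ fun y : ℍ[ℝ] => y.re := contDiff_linear (QuaternionAlgebra.reₗ _ _ _)
    have e2 : ContDiff ℝ ∞ fun y : ℍ[ℝ] => y.imI := contDiff_linear (QuaternionAlgebra.imIₗ _ _ _)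
    have e3 : ContDiff ℝ ∞ fun y : ℍ[ℝ] => y.imJ := contDiff_linear (QuaternionAlgebra.imJₗ _ _ _)
    have e4 : ContDiff ℝ ∞ fun y : ℍ[ℝ] => y.imK := contDiff_linear (QuaternionAlgebra.imKₗ _ _ _)
    unfold contractedVol
    fun_prop
  exact (((((h2.mul (((((h3 _ _ _).add (h3 _ _ _)).add (h3 _ _ _)).add
    (((h3 _ _ _).sub (h3 _ _ _)).add (h3 _ _ _))).div_const _)).add
    (((contDiff_const.mul (h1 0)).add (h1 3)).mul contDiff_const)).sub
    ((h1 1).mul (h4.div_const _))).sub ((h1 2).mul contDiff_const))).sub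
    ((h1 4).mul ((((h3 _ _ _).sub (h3 _ _ _)).add (h3 _ _ _)).div_const _))

theorem smoothFiberForm_zero (a : Fin 5 → ℝ → ℝ) (b : ℝ → ℝ) (h : a 3 0 = 3 * a 0 0)
    (v : Fin 3 → E) : smoothFiberForm a b v 0 =
      hyperkaehlerForm (-(a 2 0 / 27)) (a 0 0 / 9) fun k => fiberCoord (v k) := by
  simp [smoothFiberForm, hyperkaehlerForm, wedgeMixed, wedgeRot, contractedVol, wedge3_apply,
    rotCoord, fiberCoord, h]
  ring

theorem HasComponents.fiberForm_eq_smoothFiberForm {T : EReal} {φ : ThreeForm}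
    {f : Fin 5 → ℝ → ℝ} (hf : HasComponents T φ f) (hi : InvariantOn (regularTube T) φ)
    {a : Fin 5 → ℝ → ℝ} {b : ℝ → ℝ} {y : ℍ[ℝ]} (hy0 : y ≠ 0) (hyT : ((‖y‖ : ℝ) : EReal) < T)
    (h0 : f 0 ‖y‖ = ‖y‖ * a 0 ‖y‖) (h1 : f 1 ‖y‖ = ‖y‖ ^ 2 * (‖y‖ ^ 2 * a 1 ‖y‖))
    (h2 : f 2 ‖y‖ = a 2 ‖y‖) (h3 : f 3 ‖y‖ = ‖y‖ ^ 2 * a 3 ‖y‖)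
    (h4 : f 4 ‖y‖ = ‖y‖ ^ 2 * a 4 ‖y‖) (hb : 3 * a 0 ‖y‖ - a 3 ‖y‖ = ‖y‖ ^ 2 * b ‖y‖)
    (v : Fin 3 → E) : fiberForm φ y v = smoothFiberForm a b v y := by
  have hρ : 0 < ‖y‖ := norm_pos_iff.2 hy0
  let q : Sp1 := ⟨‖y‖⁻¹ • star y, by
    rw [mem_sphere_zero_iff_norm, norm_smul, norm_inv, norm_norm, norm_star,
      inv_mul_cancel₀ hρ.ne']⟩
  have hq : (q : ℍ[ℝ]) * y * ((1⁻¹ : Sp1) : ℍ[ℝ]) = ((‖y‖ : ℝ) : ℍ[ℝ]) := by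
    have e : star y * y = ((‖y‖ * ‖y‖ : ℝ) : ℍ[ℝ]) := by
      rw [Quaternion.star_mul_self, Quaternion.normSq_eq_norm_mul_self]
    have e1 : (((1⁻¹ : Sp1)) : ℍ[ℝ]) = 1 := by rw [inv_one]; rfl
    rw [e1, mul_one]
    simp only [q, smul_mul_assoc, e]
    rw [Quaternion.smul_coe, inv_mul_cancel_left₀ hρ.ne']
  have hw := hi.fiberForm_apply 1 q (y := y) ⟨hyT, hy0⟩ (v := v)
    (w := fun k => ((v k).1, ‖y‖⁻¹ • (star y * (v k).2)))
    (fun k => by simp) (fun k => by simp [q])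
  rw [hq] at hw
  -- Frame coordinates after the rotation: `1/‖y‖` comes from normalizing `ȳ`, the further
  -- `-1/(3‖y‖)` and `-1/3` from the frame vectors.
  let c : Fin 3 → Fin 7 → ℝ := fun k =>
    ![rotCoord y (v k) 0 / ‖y‖, -(rotCoord y (v k) 1 / (3 * ‖y‖ ^ 2)),
      -(rotCoord y (v k) 2 / (3 * ‖y‖ ^ 2)), -(rotCoord y (v k) 3 / (3 * ‖y‖ ^ 2)),
      -(fiberCoord (v k) 4 / 3), -(fiberCoord (v k) 5 / 3), -(fiberCoord (v k) 6 / 3)]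
  have hc : (fun k => ((v k).1, ‖y‖⁻¹ • (star y * (v k).2))) =
      fun k => ∑ i, c k i • frameE ‖y‖ i := by
    funext k
    refine eq_sum_frameE hρ.ne' _ ?_ ?_ ?_
    · simp [c, rotCoord, fiberCoord, div_eq_inv_mul]
    · intro i hi
      fin_cases i <;> simp at hi <;> simp [c, rotCoord, fiberCoord] <;> field_simp
    · intro i hi
      fin_cases i <;> simp at hi <;> rfl
  rw [← hw, hc, hf.fiberForm_apply hρ hyT]
  have k1 := wedge3_rotCoord y v
  have k2 := wedgeMixed_sub_wedgeRot y v
  have e456 : wedge3 4 5 6 c = -(wedge3 4 5 6 (fun k => fiberCoord (v k)) / 27) := by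
    simp only [wedge3_apply, c, Matrix.cons_val]; ring
  have e123 : wedge3 1 2 3 c = -(wedge3 1 2 3 (fun k => rotCoord y (v k)) / (27 * ‖y‖ ^ 6)) := by
    simp only [wedge3_apply, c, Matrix.cons_val]; field_simp; ring
  have eM : wedge3 0 1 4 c + wedge3 0 2 5 c + wedge3 0 3 6 c =
      wedgeMixed (fun k => rotCoord y (v k)) / (9 * ‖y‖ ^ 3) := by
    simp only [wedgeMixed, wedge3_apply, c, Matrix.cons_val,
      (rotCoord_horiz _ _).1, (rotCoord_horiz _ _).2.1, (rotCoord_horiz _ _).2.2]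
    field_simp; ring
  have eR : wedge3 1 2 6 c - wedge3 1 3 5 c + wedge3 2 3 4 c =
      -(wedgeRot (fun k => rotCoord y (v k)) / (27 * ‖y‖ ^ 4)) := by
    simp only [wedgeRot, wedge3_apply, c, Matrix.cons_val,
      (rotCoord_horiz _ _).1, (rotCoord_horiz _ _).2.1, (rotCoord_horiz _ _).2.2]
    field_simp; ring
  have e4 : wedge3 1 5 6 c - wedge3 2 4 6 c + wedge3 3 4 5 c =
      -((wedge3 1 5 6 (fun k => rotCoord y (v k)) - wedge3 2 4 6 (fun k => rotCoord y (v k)) +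
        wedge3 3 4 5 (fun k => rotCoord y (v k))) / (27 * ‖y‖ ^ 2)) := by
    simp only [wedge3_apply, c, Matrix.cons_val,
      (rotCoord_horiz _ _).1, (rotCoord_horiz _ _).2.1, (rotCoord_horiz _ _).2.2]
    field_simp; ring
  simp only [phiInv]
  rw [e456, e123, eM, eR, e4, h0, h1, h2, h3, h4, k1]
  simp only [smoothFiberForm]
  generalize wedge3 4 5 6 (fun k => fiberCoord (v k)) = X1
  generalize contractedVol y (fun k => fiberCoord (v k)) = X2
  generalize (wedge3 1 5 6 (fun k => rotCoord y (v k)) - wedge3 2 4 6 (fun k => rotCoord y (v k)) +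
        wedge3 3 4 5 (fun k => rotCoord y (v k))) = X3
  generalize hyperkaehlerForm 0 1 (fun k => fiberCoord (v k)) = X4 at k2 ⊢
  -- What remains is `3a₀M - a₃R = ½((3a₀ - a₃)(M + R) + (3a₀ + a₃)(M - R))`, with `M - R = ‖y‖²
  -- X4`.
  have k3 : wedgeMixed (fun k => rotCoord y (v k)) =
    wedgeRot (fun k => rotCoord y (v k)) + ‖y‖ ^ 2 * X4 := by linarith
  rw [k3]
  generalize wedgeRot (fun k => rotCoord y (v k)) = X5
  have hb' : b ‖y‖ = (3 * a 0 ‖y‖ - a 3 ‖y‖) / ‖y‖ ^ 2 := by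
    rw [hb]; field_simp
  rw [hb']
  field_simp
  ring

end FiberCoordinates

end NPExtension

namespace NPExtension

/-! ### Sufficiency of the conditions -/

section Sufficiency

theorem IsPositive.compContinuousLinearMap {V : Type*} [NormedAddCommGroup V] [NormedSpace ℝ V]
    {A : V [⋀^Fin 3]→L[ℝ] ℝ} (hA : IsPositive A) (L : V →L[ℝ] V)
    (hL : Function.Injective L) : IsPositive (A.compContinuousLinearMap L) := by
  obtain ⟨u, hu⟩ := hA
  have : FiniteDimensional ℝ V := u.finiteDimensional_of_finite
  let e : V ≃ₗ[ℝ] V := LinearEquiv.ofInjectiveEndo L.toLinearMap hL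
  refine ⟨u.map e.symm, fun w => ?_⟩
  exact hu fun i => L (w i)

theorem dact_injective (g : G) (p : M) : Function.Injective (dact g p) := by
  intro v w h
  have e : ∀ z, dact g⁻¹ (act g p) (dact g p z) = z := fun z => by
    rw [← dact_mul, inv_mul_cancel, dact_one]
  rw [← e v, ← e w, h]

theorem dchart_injective (x : M) {z : E} (hz : z ∈ (extChartAt IM x).target) :
    Function.Injective (dchart x z) := by
  have h := isInvertible_mfderivWithin_extChartAt_symm (I := IM) hz
  have hr : Set.range IM = Set.univ := IM.range_eq_univ
  rw [hr, mfderivWithin_univ] at h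
  obtain ⟨e, he⟩ := h
  intro v w hvw
  have h1 : ∀ v : E, dchart x z v = e v := fun v =>
    (congrArg (fun L : E →L[ℝ] E => L v) he).symm
  rw [h1, h1] at hvw
  exact e.injective hvw

variable {T : EReal} {φ ψ : ThreeForm} {f : Fin 5 → ℝ → ℝ}

theorem isPositive_localForm {U : Set M} (h : ∀ p ∈ U, IsPositive (φ p)) (x : M) {z : E}
    (hz : z ∈ chartSet x U) : IsPositive (localForm x φ z) :=
  IsPositive.compContinuousLinearMap (V := E) (h _ hz.2) (dchart x z) (dchart_injective x hz.1)

theorem continuousOn_extDeriv_apply {U : Set E} (hU : IsOpen U) {A : E → E [⋀^Fin 3]→L[ℝ] ℝ}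
    (hA : ContDiffOn ℝ ∞ A U) (w : Fin 4 → E) :
    ContinuousOn (fun z => extDeriv A z w) U := by
  have h1 : ContinuousOn (fderiv ℝ A) U := hA.continuousOn_fderiv_of_isOpen hU (by simp)
  have h2 := (ContinuousAlternatingMap.alternatizeUncurryFinCLM ℝ E ℝ
    (n := 3)).continuous.comp_continuousOn h1
  exact (ContinuousAlternatingMap.apply ℝ E ℝ w).continuous.comp_continuousOn h2

/-- A smooth positive form on the tube is nearly parallel if it is so on the regular part. -/
theorem isNearlyParallel_tube (hnp : IsNearlyParallel (regularTube T) φ)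
    (hψ : ∀ p ∈ regularTube T, ψ p = φ p) (hs : SmoothOn (tube T) ψ)
    (hpos : ∀ p ∈ tube T, IsPositive (ψ p)) : IsNearlyParallel (tube T) ψ := by
  obtain ⟨l, hl, heq⟩ := hnp.equation
  refine ⟨hs, hpos, l, hl, fun x z hz v w => ?_⟩
  have hreg : ∀ y ∈ chartSet x (regularTube T),
      extDeriv (localForm x ψ) y w = l * hodgeDual v (localForm x ψ y) w := by
    intro y hy
    have hloc : ∀ y ∈ chartSet x (regularTube T), localForm x ψ y = localForm x φ y := by
      intro y hy
      simp only [localForm, hψ _ hy.2]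
    have hev : localForm x ψ =ᶠ[nhds y] localForm x φ := by
      filter_upwards [(isOpen_chartSet x (isOpen_regularTube T)).mem_nhds hy] using hloc
    rw [hev.extDeriv_eq, hloc y hy]
    exact heq x y hy v w
  by_cases h0 : z.2 = 0
  · have hopen := isOpen_chartSet x (isOpen_tube T)
    have hc1 : ContinuousAt (fun y => extDeriv (localForm x ψ) y w) z :=
      (continuousOn_extDeriv_apply hopen (hs x) w).continuousAt (hopen.mem_nhds hz)
    have hc2 : ContinuousAt (fun y => l * hodgeDual v (localForm x ψ y) w) z :=
      continuousAt_const.mul (continuousAt_hodgeDual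
        ((hs x).continuousOn.continuousAt (hopen.mem_nhds hz)) v w
        ((isPositive_localForm hpos x hz).det_betaMatrix_ne_zero v))
    -- The point is approached through the regular part along the real axis of the fibre; both sides
    -- are continuous and agree there.
    have hcurve : Filter.Tendsto (fun t : ℝ => (z.1, (t : ℍ[ℝ]))) (nhdsWithin 0 (Set.Ioi 0))
        (nhds z) := by
      have h1 : Continuous fun t : ℝ => ((z.1, (t : ℍ[ℝ])) : E) :=
        continuous_const.prodMk contDiff_coe_quaternion.continuous
      have h2 : ((z.1, ((0 : ℝ) : ℍ[ℝ])) : E) = z := Prod.ext rfl (by simp [h0])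
      have h3 := h1.tendsto 0
      rw [h2] at h3
      exact h3.mono_left nhdsWithin_le_nhds
    refine tendsto_nhds_unique (hc1.tendsto.comp hcurve) ((hc2.tendsto.comp hcurve).congr' ?_)
    filter_upwards [hcurve.eventually (hopen.mem_nhds hz), self_mem_nhdsWithin] with t ht1 ht2
    refine (hreg _ ⟨ht1.1, ht1.2, ?_⟩).symm
    rw [chart_symm_snd]
    intro h
    exact (ne_of_gt (Set.mem_Ioi.1 ht2)) (by simpa using congrArg QuaternionAlgebra.re h)
  · exact hreg z ⟨hz.1, hz.2, h0⟩

/-- Since `(q₁ x q₃⁻¹)⁻¹ q₁ = q₃ x⁻¹`, in the left trivialization `g` acts on the sphere directions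
by conjugation with `q₃`. Thus invariance under `G` reduces to equivariance under `K⁺`. -/
theorem dcoe_dact_toFiber_act (g : G) (p : M) (z : E) :
    dcoe 1 (dact (toFiber (act g p)) (act g p) (dact g p z)).1 =
      (g.2.2 : ℍ[ℝ]) * dcoe 1 (dact (toFiber p) p z).1 * ((g.2.2⁻¹ : Sp1) : ℍ[ℝ]) := by
  have h1 := dcoe_dact_fst (toFiber p) p z
  have h2 := dcoe_dact_fst (toFiber (act g p)) (act g p) (dact g p z)
  rw [act_toFiber] at h1 h2
  rw [dcoe_dact_fst] at h2
  refine h2.trans ?_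
  refine Eq.trans ?_ (congrArg (fun z => (g.2.2 : ℍ[ℝ]) * z * ((g.2.2⁻¹ : Sp1) : ℍ[ℝ])) h1.symm)
  have e1 : (toFiber (act g p)).1 = g.2.2 * p.1⁻¹ * g.1⁻¹ := by
    simp [toFiber, act, mul_assoc]
  have e2 : ((g.2.2 * p.1⁻¹ * g.1⁻¹ : Sp1) : ℍ[ℝ]) =
    (g.2.2 : ℍ[ℝ]) * ((p.1⁻¹ : Sp1) : ℍ[ℝ]) * ((g.1⁻¹ : Sp1) : ℍ[ℝ]) := rfl
  have e3 : ((g.1⁻¹ : Sp1) : ℍ[ℝ]) * (g.1 : ℍ[ℝ]) = 1 :=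
    congrArg Subtype.val (inv_mul_cancel g.1)
  have e4 : ∀ p : M, (((toFiber p).2.2⁻¹ : Sp1) : ℍ[ℝ]) = 1 := fun p =>
    congrArg Subtype.val (inv_one (G := Sp1))
  have e5 : ((toFiber p).1 : ℍ[ℝ]) = ((p.1⁻¹ : Sp1) : ℍ[ℝ]) := rfl
  rw [e4, e4, e1, e2, e5, mul_one, mul_one]
  simp only [mul_assoc]
  rw [← mul_assoc ((g.1⁻¹ : Sp1) : ℍ[ℝ]), e3, one_mul]

theorem invariantOn_ofFiberForm {U : Set M} {Ψ : ℍ[ℝ] → E [⋀^Fin 3]→L[ℝ] ℝ}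
    (h : ∀ (q q' : Sp1), ∀ p ∈ U, ∀ v w : Fin 3 → E,
      (∀ i, dcoe 1 (w i).1 = (q : ℍ[ℝ]) * dcoe 1 (v i).1 * ((q⁻¹ : Sp1) : ℍ[ℝ])) →
      (∀ i, (w i).2 = (q' : ℍ[ℝ]) * (v i).2 * ((q⁻¹ : Sp1) : ℍ[ℝ])) →
      Ψ ((q' : ℍ[ℝ]) * p.2 * ((q⁻¹ : Sp1) : ℍ[ℝ])) w = Ψ p.2 v) :
    InvariantOn U (ofFiberForm Ψ) := by
  intro g p hp
  refine ContinuousAlternatingMap.ext fun v => ?_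
  refine h g.2.2 g.2.1 p hp (fun i => dact (toFiber p) p (v i))
    (fun i => dact (toFiber (act g p)) (act g p) (dact g p (v i))) (fun i => ?_) fun i => ?_
  · exact dcoe_dact_toFiber_act g p (v i)
  · have h0 : ∀ (p : M) (z : E), (dact (toFiber p) p z).2 = z.2 := fun p z => by
      rw [dact_snd]
      simp [toFiber]
    exact (h0 _ _).trans ((dact_snd g p (v i)).trans
      (congrArg (fun z => (g.2.1 : ℍ[ℝ]) * z * ((g.2.2⁻¹ : Sp1) : ℍ[ℝ])) (h0 p (v i)).symm))

theorem norm_mul_mul_inv (q q' : Sp1) (y : ℍ[ℝ]) :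
    ‖(q' : ℍ[ℝ]) * y * ((q⁻¹ : Sp1) : ℍ[ℝ])‖ = ‖y‖ := by
  rw [norm_mul, norm_mul, norm_eq_of_mem_sphere, norm_eq_of_mem_sphere, one_mul, mul_one]

/-- The fibre form extends smoothly over the origin, with a nondegenerate value there. -/
theorem exists_fiberForm_extension (hi : InvariantOn (regularTube T) φ)
    (hnp : IsNearlyParallel (regularTube T) φ) (hf : HasComponents T φ f)
    (hc : ExtensionConditions T f) :
    ∃ δ : ℝ, 0 < δ ∧ (δ : EReal) ≤ T ∧ ∃ B : ℍ[ℝ] → E [⋀^Fin 3]→L[ℝ] ℝ, ContDiff ℝ ∞ B ∧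
      (∀ y, y ≠ 0 → ‖y‖ < δ → B y = fiberForm φ y) ∧ IsPositive (B 0) := by
  obtain ⟨ε, hε, hεT, F, hF, hFf, hodd, heven, hF1, hF3, hF4, hF1', hF03, hF2, hF0⟩ := hc
  choose K hK hKF hKe hKo using fun k => exists_contDiff_eq_near_zero hε (hF k)
  have h3pos : 0 < ε / 3 := by linarith
  have hmem0 : (0 : ℝ) ∈ Set.Ioo (-(ε / 3)) (ε / 3) := ⟨by linarith, by linarith⟩
  have hnear : ∀ k, K k =ᶠ[nhds 0] F k := fun k => by
    filter_upwards [eventually_mem_Ioo h3pos] with t ht using hKF k t ht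
  have hKeven : ∀ k, k ≠ 0 → Function.Even (K k) := fun k hk => hKe k (heven k hk)
  obtain ⟨a0, ha0, ha0e, ha0K⟩ := exists_even_eq_mul_of_odd (hK 0) (hKo 0 hodd)
  obtain ⟨u, hu, hue, huK⟩ := exists_even_eq_sq_mul (hK 1) (hKeven 1 (by decide))
    ((hKF 1 0 hmem0).trans hF1)
  obtain ⟨a3, ha3, ha3e, ha3K⟩ := exists_even_eq_sq_mul (hK 3) (hKeven 3 (by decide))
    ((hKF 3 0 hmem0).trans hF3)
  obtain ⟨a4, ha4, ha4e, ha4K⟩ := exists_even_eq_sq_mul (hK 4) (hKeven 4 (by decide))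
    ((hKF 4 0 hmem0).trans hF4)
  -- The condition `f₁''(0) = 0` permits a second division by `t²`, giving `f₁ = t⁴ a₁`.
  have hu0 : u 0 = 0 := by
    have h1 : iteratedDeriv 2 (K 1) 0 = 2 * u 0 := by
      rw [show K 1 = fun t => t ^ 2 * u t from funext huK, iteratedDeriv_two_sq_mul hu]
    rw [(hnear 1).iteratedDeriv_eq, hF1'] at h1
    linarith
  obtain ⟨a1, ha1, ha1e, ha1u⟩ := exists_even_eq_sq_mul hu hue hu0
  have ha00 : a0 0 = deriv (F 0) 0 := by
    rw [← (hnear 0).deriv_eq, show K 0 = fun t => t * a0 t from funext ha0K,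
      deriv_mul_self_of_contDiffOn hε ha0.contDiffOn]
  -- This is `6f₀'(0) = f₃''(0)`; it makes `3a₀ - a₃` divisible by `t²`.
  have ha30 : a3 0 = 3 * a0 0 := by
    have h1 : iteratedDeriv 2 (K 3) 0 = 2 * a3 0 := by
      rw [show K 3 = fun t => t ^ 2 * a3 t from funext ha3K, iteratedDeriv_two_sq_mul ha3]
    rw [(hnear 3).iteratedDeriv_eq, ← hF03, ← ha00] at h1
    linarith
  obtain ⟨b, hb, hbe, hba⟩ := exists_even_eq_sq_mul (h := fun t => 3 * a0 t - a3 t)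
    ((contDiff_const.mul ha0).sub ha3) (fun t => by simp only [ha0e t, ha3e t]) (by
      simp only [ha30, sub_self])
  let a : Fin 5 → ℝ → ℝ := ![a0, a1, K 2, a3, a4]
  have ha : ∀ k, ContDiff ℝ ∞ (a k) := fun k => by
    fin_cases k
    exacts [ha0, ha1, hK 2, ha3, ha4]
  have hae : ∀ k, Function.Even (a k) := fun k => by
    fin_cases k
    exacts [ha0e, ha1e, hKeven 2 (by decide), ha3e, ha4e]
  have hKf : ∀ k, ∀ t ∈ Set.Ioo 0 (ε / 3), f k t = K k t := fun k t ht => by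
    rw [hKF k t ⟨by linarith [ht.1], ht.2⟩, hFf k t ⟨ht.1, by linarith [ht.2]⟩]
  have hltT : ∀ t : ℝ, t < ε / 3 → (t : EReal) < T := fun t ht =>
    lt_of_lt_of_le (by exact_mod_cast (by linarith : t < ε)) hεT
  have hS : ∀ v, ∀ y ∈ {y : ℍ[ℝ] | y ≠ 0 ∧ ‖y‖ < ε / 3},
      fiberForm φ y v = smoothFiberForm a b v y := by
    rintro v y ⟨hy0, hy⟩
    have hm : ‖y‖ ∈ Set.Ioo 0 (ε / 3) := ⟨norm_pos_iff.2 hy0, hy⟩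
    exact hf.fiberForm_eq_smoothFiberForm (a := a) (b := b) hi hy0 (hltT _ hy)
      ((hKf 0 _ hm).trans (ha0K _)) (by rw [hKf 1 _ hm, huK, ha1u]; rfl) (hKf 2 _ hm)
      ((hKf 3 _ hm).trans (ha3K _)) ((hKf 4 _ hm).trans (ha4K _)) (hba _) v
  have hSc := fun v => contDiff_smoothFiberForm ha hae hb hbe v
  obtain ⟨B, hB, hBφ⟩ := exists_contDiff_alternating_extension (smoothFiberForm a b) hSc hS
  have hεε : ((ε / 3 : ℝ) : EReal) ≤ ε := by exact_mod_cast (by linarith : ε / 3 ≤ ε)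
  refine ⟨ε / 3, h3pos, hεε.trans hεT,
    B, hB, fun y h0 hy => hBφ y ⟨h0, hy⟩, ?_⟩
  have hcoe : ∀ t ∈ Set.Ioo 0 (ε / 3), ((t : ℝ) : ℍ[ℝ]) ∈ {y : ℍ[ℝ] | y ≠ 0 ∧ ‖y‖ < ε / 3} := by
    intro t ht
    refine ⟨fun h => ht.1.ne' (by simpa using congrArg QuaternionAlgebra.re h), ?_⟩
    rw [Quaternion.norm_coe, Real.norm_eq_abs, abs_of_pos ht.1]
    exact ht.2
  -- The fibre form says nothing about `B` at the origin itself; the value is the limit along real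
  -- `t > 0`.
  have hB0 : ∀ v, B 0 v =
      hyperkaehlerForm (-(a 2 0 / 27)) (a 0 0 / 9) fun k => fiberCoord (v k) := by
    intro v
    rw [← smoothFiberForm_zero a b ha30]
    have h1 : ContDiff ℝ ∞ fun t : ℝ => B (t : ℍ[ℝ]) v :=
      contDiffOn_univ.1 (contDiffOn_alternating_iff.1
        (hB.comp contDiff_coe_quaternion).contDiffOn v)
    have h2 := eq_at_zero_of_eq_on_pos h3pos h1.contDiffOn
      ((hSc v).comp contDiff_coe_quaternion).contDiffOn fun t ht => by
        rw [hBφ _ (hcoe t ht), hS v _ (hcoe t ht)]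
        rfl
    simpa using h2
  -- Dividing `f₂f₃ ≤ f₄²` by `t²` gives `f₂ a₃ ≤ t² a₄²`, and `t → 0` fixes the sign that condition
  -- (4) leaves open.
  have hle : a 2 0 * a 3 0 ≤ 0 := by
    have h1 : ∀ t ∈ Set.Ioo 0 (ε / 3), a 2 t * a 3 t ≤ t ^ 2 * a 4 t ^ 2 := by
      intro t ht
      have h2 := (hnp.positive (1, (t : ℍ[ℝ])) (coe_mem_regularTube
        (hεT) ⟨ht.1, by linarith [ht.2]⟩)).phiInv_le (linearIndependent_frameE ht.1.ne')
        (fun z => ⟨![fiberCoord z 0, -(fiberCoord z 1 / (3 * t)), -(fiberCoord z 2 / (3 * t)),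
          -(fiberCoord z 3 / (3 * t)), -(fiberCoord z 4 / 3), -(fiberCoord z 5 / 3),
          -(fiberCoord z 6 / 3)], eq_sum_frameE ht.1.ne' z rfl
            (fun i hi => by fin_cases i <;> simp at hi <;> rfl)
            (fun i hi => by fin_cases i <;> simp at hi <;> rfl)⟩)
        (hf.fiberForm_apply ht.1 (hltT t ht.2))
      rw [hKf 2 t ht, hKf 3 t ht, hKf 4 t ht, ha3K, ha4K] at h2
      have h3 : t ^ 2 * (a 2 t * a 3 t) ≤ t ^ 2 * (t ^ 2 * a 4 t ^ 2) := by
        calc t ^ 2 * (a 2 t * a 3 t) = K 2 t * (t ^ 2 * a3 t) := by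
              change t ^ 2 * (K 2 t * a3 t) = _; ring
          _ ≤ (t ^ 2 * a4 t) ^ 2 := h2
          _ = t ^ 2 * (t ^ 2 * a 4 t ^ 2) := by
              change _ = t ^ 2 * (t ^ 2 * a4 t ^ 2); ring
      exact le_of_mul_le_mul_left h3 (by have := ht.1; positivity)
    have hl : Filter.Tendsto (fun t => a 2 t * a 3 t) (nhdsWithin 0 (Set.Ioi 0))
        (nhds (a 2 0 * a 3 0)) :=
      (((ha 2).continuous.mul (ha 3).continuous).tendsto 0).mono_left nhdsWithin_le_nhds
    have hr : Filter.Tendsto (fun t => t ^ 2 * a 4 t ^ 2) (nhdsWithin 0 (Set.Ioi 0)) (nhds 0) := by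
      have h4 := ((continuous_pow 2).mul ((ha 4).continuous.pow 2)).tendsto (0 : ℝ)
      simp only [Pi.mul_apply, Pi.pow_apply] at h4
      have h5 : (0 : ℝ) ^ 2 * a 4 0 ^ 2 = 0 := by ring
      rw [h5] at h4
      exact h4.mono_left nhdsWithin_le_nhds
    refine le_of_tendsto_of_tendsto hl hr ?_
    filter_upwards [Ioo_mem_nhdsGT h3pos] with t ht using h1 t ht
  have hne2 : a 2 0 ≠ 0 := by
    change K 2 0 ≠ 0
    rwa [hKF 2 0 hmem0]
  have hne0 : a 0 0 ≠ 0 := by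
    change a0 0 ≠ 0
    rwa [ha00]
  have h30 : a 3 0 = 3 * a 0 0 := ha30
  have hlt : a 2 0 * a 0 0 < 0 := lt_of_le_of_ne (by rw [h30] at hle; linarith)
    (mul_ne_zero hne2 hne0)
  refine isPositive_of_hyperkaehlerForm fiberBasis (a := -(a 2 0 / 27)) (b := a 0 0 / 9)
    (by linarith) fun w => ?_
  exact hB0 w

theorem exists_extension (hi : InvariantOn (regularTube T) φ)
    (hnp : IsNearlyParallel (regularTube T) φ) (hf : HasComponents T φ f)
    (hc : ExtensionConditions T f) :
    ∃ ψ : ThreeForm, (∀ p ∈ regularTube T, ψ p = φ p) ∧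
      InvariantOn (tube T) ψ ∧ IsNearlyParallel (tube T) ψ := by
  classical
  obtain ⟨δ, hδ, hδT, B, hB, hBφ, hpos⟩ := exists_fiberForm_extension hi hnp hf hc
  -- The extension `B` is known to match only for `‖y‖ < δ`, so only its value at the origin is
  -- used.
  let Ψ : ℍ[ℝ] → E [⋀^Fin 3]→L[ℝ] ℝ := fun y => if y = 0 then B 0 else fiberForm φ y
  have hΨ0 : Ψ 0 = B 0 := if_pos rfl
  have hΨ : ∀ y, y ≠ 0 → Ψ y = fiberForm φ y := fun y hy => if_neg hy
  have hψ : ∀ p ∈ regularTube T, ofFiberForm Ψ p = φ p := by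
    intro p hp
    rw [hi.eq_ofFiberForm hp, ofFiberForm, ofFiberForm, hΨ p.2 hp.2]
  have hsm : ContDiffOn ℝ ∞ Ψ {y | ((1, y) : M) ∈ tube T} := by
    intro y hy
    refine ContDiffAt.contDiffWithinAt ?_
    by_cases hy0 : y = 0
    · subst hy0
      refine hB.contDiffAt.congr_of_eventuallyEq ?_
      filter_upwards [Metric.ball_mem_nhds (0 : ℍ[ℝ]) hδ] with z hz
      by_cases hz0 : z = 0
      · rw [hz0, hΨ0]
      · rw [hΨ z hz0, hBφ z hz0 (by simpa using hz)]
    · have hopen : IsOpen {y : ℍ[ℝ] | ((1, y) : M) ∈ regularTube T} :=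
        (isOpen_regularTube T).preimage (continuous_const.prodMk continuous_id)
      refine (hnp.smooth.contDiffOn_fiberForm.contDiffAt
        (hopen.mem_nhds ⟨hy, hy0⟩)).congr_of_eventuallyEq ?_
      filter_upwards [isOpen_ne.mem_nhds hy0] with z hz using hΨ z hz
  have hsmooth : SmoothOn (tube T) (ofFiberForm Ψ) := smoothOn_ofFiberForm hsm fun p hp => hp
  have hinv : InvariantOn (tube T) (ofFiberForm Ψ) := by
    refine invariantOn_ofFiberForm fun q q' p hp v w h1 h2 => ?_
    have hne : ∀ y : ℍ[ℝ], y ≠ 0 → (q' : ℍ[ℝ]) * y * ((q⁻¹ : Sp1) : ℍ[ℝ]) ≠ 0 := fun y hy => by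
      rw [← norm_ne_zero_iff, norm_mul_mul_inv]
      exact norm_ne_zero_iff.2 hy
    by_cases h0 : p.2 = 0
    · rw [h0, mul_zero, zero_mul, hΨ0]
      have hcont : ∀ {c : ℝ → ℍ[ℝ]}, ContDiff ℝ ∞ c → ∀ u : Fin 3 → E,
          ContDiffOn ℝ ∞ (fun t => B (c t) u) (Set.Ioo (-δ) δ) := fun hc u =>
        contDiffOn_alternating_iff.1 (hB.comp hc).contDiffOn u
      -- Equivariance at the origin is the limit of equivariance along `t` and `q' t q⁻¹` as `t`
      -- decreases to `0`.
      have h3 := eq_at_zero_of_eq_on_pos hδ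
        (hcont ((contDiff_const.mul contDiff_coe_quaternion).mul contDiff_const :
          ContDiff ℝ ∞ fun t : ℝ => (q' : ℍ[ℝ]) * (t : ℍ[ℝ]) * ((q⁻¹ : Sp1) : ℍ[ℝ])) w)
        (hcont contDiff_coe_quaternion v) fun t ht => by
          have hreg := coe_mem_regularTube hδT ht
          have hn : ‖((t : ℝ) : ℍ[ℝ])‖ < δ := by
            rw [Quaternion.norm_coe, Real.norm_eq_abs, abs_of_pos ht.1]
            exact ht.2
          rw [hBφ _ (hne _ hreg.2) (by rw [norm_mul_mul_inv]; exact hn), hBφ _ hreg.2 hn]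
          exact hi.fiberForm_apply q q' hreg h1 h2
      simpa using h3
    · rw [hΨ _ h0, hΨ _ (hne _ h0)]
      exact hi.fiberForm_apply q q' (y := p.2) ⟨hp, h0⟩ h1 h2
  refine ⟨ofFiberForm Ψ, hψ, hinv, isNearlyParallel_tube hnp hψ hsmooth fun p hp => ?_⟩
  by_cases h0 : p.2 = 0
  · refine IsPositive.compContinuousLinearMap (V := E) ?_ (dact (toFiber p) p)
      (dact_injective _ _)
    rw [h0, hΨ0]
    exact hpos
  · rw [hψ p ⟨hp, h0⟩]
    exact hnp.positive p ⟨hp, h0⟩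

end Sufficiency

end NPExtension

/-! ### The extension theorem -/

open NPExtension

theorem mainTheorem3 (T : EReal) (hT : 0 < T) (φ : ThreeForm) (f : Fin 5 → ℝ → ℝ)
    (hinv : InvariantOn (regularTube T) φ)
    (hnp : IsNearlyParallel (regularTube T) φ)
    (hf : HasComponents T φ f) :
    (∃ ψ : ThreeForm, (∀ p ∈ regularTube T, ψ p = φ p) ∧
      InvariantOn (tube T) ψ ∧ IsNearlyParallel (tube T) ψ) ↔
    ExtensionConditions T f := by
  constructor
  · rintro ⟨ψ, hψ, hi, hψp⟩
    exact extensionConditions_of_extension hT hf hψ hi hψp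
  · exact exists_extension hinv hnp hf
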